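/- Let $k\ge 2$ be an integer. A positive integer $m$ is called $k$-full if $p^k\mid m$ for every prime factor $p$ of $m$; let $\mathcal S_k$ be the set of $k$-full integers that are not perfect $k$th powers. Let $$\Lambda_k=\left\{(b_1^{k+1}b_2^{k+2}\cdots b_{k-1}^{2k-1})^{1/k}\;:\; b_1,\dots,b_{k-1}\in\mathbb Z_{\ge1},\ b_1\cdots b_{k-1}\ge 2,\ b_1\cdots b_{k-1}\text{ squarefree}\right\}.$$ Then the infinite product $C_k=\prod_{\lambda\in\Lambda_k}\left(1-\frac{2}{\lambda}\right)$ converges (unconditionally) to a positive number, and the set $$\mathcal B^{(k)}=\{n\in\mathbb Z_{\ge1} : (n^k,(n+2)^k)\cap\mathcal S_k=\varnothing\}$$ has asymptotic density $C_k>0$, that is, $\lim_{x\to\infty}\frac1x\#\{n\in\mathcal B^{(k)}: n\le x\}=C_k$. In particular, there are infinitely many positive integers $n$ such that the interval $(n^k,(n+2)^k)$ contains no $k$-full integer other than $(n+1)^k$. For $k=2$ the density is $C_2=0.049227\ldots$, that is, $0.049227\le C_2<0.049228$. -/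

import Mathlib

open Filter Topology

namespace KFull

/-- A positive integer `m` is `k`-full if `p ^ k ∣ m` for every prime factor `p` of `m`. -/
def IsFull (k m : ℕ) : Prop :=
  0 < m ∧ ∀ p : ℕ, p.Prime → p ∣ m → p ^ k ∣ m

/-- The set of all `k`-full integers that are not perfect `k`th powers. -/
def S (k : ℕ) : Set ℕ :=
  {m | IsFull k m ∧ ¬ ∃ a : ℕ, m = a ^ k}

/-- The set of real numbers `(b₁ ^ (k+1) * b₂ ^ (k+2) * ⋯ * b_{k-1} ^ (2k-1)) ^ (1/k)` with positive
integers `b₁, …, b_{k-1}` whose product is squarefree and at least `2`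
(the index `i : Fin (k - 1)` stands for the subscript `i + 1`). -/
def Lambda (k : ℕ) : Set ℝ :=
  {x | ∃ b : Fin (k - 1) → ℕ, (∀ i, 1 ≤ b i) ∧ 2 ≤ ∏ i, b i ∧ Squarefree (∏ i, b i) ∧
    x = (∏ i, (b i : ℝ) ^ (k + 1 + (i : ℕ))) ^ ((1 : ℝ) / (k : ℝ))}

/-- The constant `C_k`, the product of `1 - 2 / l` over all `l` in `Lambda k`. -/
noncomputable def C (k : ℕ) : ℝ :=
  ∏' l : Lambda k, (1 - 2 / (l : ℝ))

/-- The positive integers `n` such that the open interval `(n ^ k, (n + 2) ^ k)` contains no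
`k`-full integer that is not a perfect `k`th power. -/
def B (k : ℕ) : Set ℕ :=
  {n | 1 ≤ n ∧ Set.Ioo (n ^ k) ((n + 2) ^ k) ∩ S k = ∅}

/-- The set `A` of positive integers has asymptotic density `d`: the number of elements of `A` not
exceeding `x`, divided by `x`, tends to `d` as the real number `x` tends to infinity. -/
def HasDensity (A : Set ℕ) (d : ℝ) : Prop :=
  Tendsto (fun x : ℝ => (({n : ℕ | n ∈ A ∧ (n : ℝ) ≤ x}.ncard : ℕ) : ℝ) / x) atTop (𝓝 d)

end KFull

/-! A `k`-full integer that is not a `k`th power is exactly a number `(a * l) ^ k` with `a ≥ 1` and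
`l ∈ Lambda k` (`mem_S_iff`). So `n ∈ B k` means that no multiple of any `l` lies in `(n, n + 2)`.
Since `l > 2`, this says that the fractional part of `n / l` is at most `1 - 2 / l`
(`forall_not_between_iff`).

For finitely many `l`, Weyl equidistribution gives density `∏ (1 - 2 / l)`, provided that `1` and
the numbers `1 / l` are linearly independent over `ℚ`. These are positive real radicals whose
pairwise quotients are irrational. An irrational positive radical has minimal polynomial `X ^ d - r`
with `d ≥ 2`, hence trace zero. Dividing a linear relation by one of its radicals and taking traces
kills every other term, so that coefficient vanishes (`linearIndependent_radicals`).

The passage to all `l` rests on two facts: `∑ 1 / l` converges, because the exponents `(k + i) / k`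
exceed `1`; and the number of `n ≤ x` spoiled by one `l` is at most `2 (x + 2) / l`, with no
additive error (`ncard_between_le`). Hence a cofinite set of `l` spoils an arbitrarily small
proportion of integers, uniformly for large `x`. Positivity of `C k` then gives infinitely many `n`.

For `k = 2`, `l = b ^ (3/2)` with `b ≥ 2` squarefree. The factors with `b ≤ 1000` are multiplied
out. The logarithm of the rest is `-2 ∑ b ^ (-3/2)` up to an error controlled by `∑ n ^ (-3)`, and
the full squarefree sum is `ζ(3/2) / ζ(3)`, so only these two zeta values are needed precisely. -/

namespace KFull

/-! ### Rational independence of real radicals, by traces. -/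

section Radicals

open Polynomial

/-- If a positive real number has a positive rational power, then its minimal polynomial over `ℚ`
is `X ^ d - q` for some rational `q`. -/
lemma minpoly_eq_X_pow_sub_C {x : ℝ} (hx : 0 < x) {n : ℕ} (hn : n ≠ 0) {q : ℚ}
    (hq : x ^ n = q) :
    ∃ r : ℚ, minpoly ℚ x = X ^ (minpoly ℚ x).natDegree - Polynomial.C r := by
  have hint : IsIntegral ℚ x := by
    refine ⟨X ^ n - Polynomial.C q, monic_X_pow_sub_C q hn, ?_⟩
    simp [hq]
  set p := minpoly ℚ x with hp
  have hmonic : p.Monic := minpoly.monic hint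
  have hdvd : p ∣ X ^ n - Polynomial.C q := minpoly.dvd ℚ x (by simp [hq])
  have hsplit : (p.map (algebraMap ℚ ℂ)).Splits := IsAlgClosed.splits _
  have hroot : ∀ z ∈ p.aroots ℂ, ‖z‖ = x := by
    intro z hz
    have hz0 : aeval z p = 0 := (mem_aroots.1 hz).2
    have hz1 : aeval z (X ^ n - Polynomial.C q : ℚ[X]) = 0 := by
      obtain ⟨s, hs⟩ := hdvd
      rw [hs, map_mul, hz0, zero_mul]
    have hz2 : z ^ n = (q : ℂ) := by
      have := hz1
      simp only [map_sub, map_pow, aeval_X, aeval_C, eq_ratCast] at this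
      exact sub_eq_zero.1 this
    have h3 : ‖z‖ ^ n = x ^ n := by
      rw [← norm_pow, hz2, hq, ← Complex.ofReal_ratCast, ← hq, Complex.norm_real, norm_pow,
        Real.norm_of_nonneg hx.le]
    exact (pow_left_inj₀ (norm_nonneg z) hx.le hn).1 h3
  have hcard : Multiset.card (p.aroots ℂ) = p.natDegree := by
    have := hsplit.natDegree_eq_card_roots
    rw [natDegree_map] at this
    exact this.symm
  -- Every conjugate of `x` is a root of `X ^ n - q`, so has modulus `x`; the constant coefficient
  -- is their product up to sign. Thus `x ^ d` is already rational for `d` the degree, and `X ^ d -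
  -- |p.coeff 0|` must be the minimal polynomial.
  have hnorm : |((p.coeff 0 : ℚ) : ℝ)| = x ^ p.natDegree := by
    have h1 := hsplit.coeff_zero_eq_prod_roots_of_monic (hmonic.map _)
    have h2 : ‖(p.map (algebraMap ℚ ℂ)).coeff 0‖ = x ^ p.natDegree := by
      rw [h1, norm_mul, norm_pow, norm_neg, norm_one, one_pow, one_mul, ← hcard]
      change ‖(p.aroots ℂ).prod‖ = _
      rw [show ‖(p.aroots ℂ).prod‖ = ((p.aroots ℂ).map (fun z => ‖z‖)).prod from
        (Multiset.prod_hom _ (normHom : ℂ →*₀ ℝ)).symm, Multiset.map_congr rfl hroot,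
        Multiset.map_const', Multiset.prod_replicate]
    rw [← h2, coeff_map, eq_ratCast, ← Complex.ofReal_ratCast, Complex.norm_real, Real.norm_eq_abs]
  refine ⟨|p.coeff 0|, ?_⟩
  have hd : p.natDegree ≠ 0 := (minpoly.natDegree_pos hint).ne'
  symm
  apply minpoly.unique_of_degree_le_degree_minpoly ℚ x (monic_X_pow_sub_C _ hd)
  · simp [← hnorm]
  · rw [degree_X_pow_sub_C (Nat.pos_of_ne_zero hd), degree_eq_natDegree hmonic.ne_zero]

/-- An irrational positive real number with a rational power has trace zero. -/
lemma trace_eq_zero_of_irrational_radical (K : IntermediateField ℚ ℝ) [FiniteDimensional ℚ K]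
    (x : K) (hx : 0 < (x : ℝ)) {n : ℕ} (hn : n ≠ 0) {q : ℚ} (hq : (x : ℝ) ^ n = q)
    (hirr : Irrational (x : ℝ)) : Algebra.trace ℚ K x = 0 := by
  rw [trace_eq_finrank_mul_minpoly_nextCoeff]
  obtain ⟨r, hr⟩ := minpoly_eq_X_pow_sub_C hx hn hq
  have hint : IsIntegral ℚ (x : ℝ) := by
    refine ⟨X ^ n - Polynomial.C q, monic_X_pow_sub_C q hn, ?_⟩
    simp [hq]
  have hmp : minpoly ℚ x = minpoly ℚ (x : ℝ) :=
    (minpoly.algebraMap_eq (algebraMap K ℝ).injective x).symm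
  -- With `d ≥ 2`, the polynomial `X ^ d - r` has no term of degree `d - 1`, the coefficient that
  -- determines the trace.
  have hdeg : 2 ≤ (minpoly ℚ (x : ℝ)).natDegree := by
    rw [minpoly.two_le_natDegree_iff hint]
    rintro ⟨y, hy⟩
    exact hirr ⟨y, by simpa using hy⟩
  rw [hmp, hr]
  set d := (minpoly ℚ (x : ℝ)).natDegree
  have : (X ^ d - Polynomial.C r).nextCoeff = 0 := by
    rw [nextCoeff_of_natDegree_pos (by rw [natDegree_X_pow_sub_C]; omega), natDegree_X_pow_sub_C,
      coeff_sub, coeff_X_pow, coeff_C, if_neg (by omega), if_neg (by omega), sub_zero]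
  rw [this]; simp

/-- Positive real `k`-th roots of rational numbers whose pairwise quotients are irrational are
linearly independent over `ℚ`. -/
lemma linearIndependent_radicals {ι : Type*} [Fintype ι] (α : ι → ℝ) (hα : ∀ i, 0 < α i)
    {n : ℕ} (hn : n ≠ 0) (hq : ∀ i, ∃ q : ℚ, α i ^ n = q)
    (hirr : ∀ i j, i ≠ j → Irrational (α i / α j)) (c : ι → ℚ)
    (hc : ∑ i, (c i : ℝ) * α i = 0) (j : ι) : c j = 0 := by
  classical
  let K : IntermediateField ℚ ℝ := IntermediateField.adjoin ℚ (Set.range α)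
  have hfin : FiniteDimensional ℚ K := by
    apply IntermediateField.finiteDimensional_adjoin
    rintro _ ⟨i, rfl⟩
    obtain ⟨q, hq⟩ := hq i
    refine ⟨X ^ n - Polynomial.C q, monic_X_pow_sub_C q hn, ?_⟩
    simp [hq]
  have hmem : ∀ i, α i ∈ K := fun i => IntermediateField.subset_adjoin ℚ _ ⟨i, rfl⟩
  -- After division by `α j`, the `j`th term becomes `1`, of nonzero trace, and all others are
  -- irrational radicals, of trace zero.
  let β : ι → K := fun i => ⟨α i / α j, K.div_mem (hmem i) (hmem j)⟩
  have hsum : ∑ i, c i • β i = 0 := by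
    apply Subtype.ext
    have : ((∑ i, c i • β i : K) : ℝ) = ∑ i, (c i : ℝ) * (α i / α j) := by
      rw [← IntermediateField.coe_val, map_sum]
      refine Finset.sum_congr rfl fun i _ => ?_
      rw [IntermediateField.coe_val, IntermediateField.coe_smul, Rat.smul_def]
    rw [this]
    simp_rw [← mul_div_assoc]
    rw [← Finset.sum_div, hc, zero_div]; rfl
  have htr : ∑ i, c i * Algebra.trace ℚ K (β i) = 0 := by
    have := congrArg (Algebra.trace ℚ K) hsum
    simpa [map_sum] using this
  rw [Finset.sum_eq_single j] at htr
  · have h1 : β j = 1 := Subtype.ext (div_self (hα j).ne')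
    rw [h1, ← map_one (algebraMap ℚ K), Algebra.trace_algebraMap] at htr
    have hpos := Module.finrank_pos (R := ℚ) (M := K)
    simpa [hpos.ne'] using htr
  · intro i _ hij
    obtain ⟨q, hq1⟩ := hq i
    obtain ⟨r, hr1⟩ := hq j
    rw [trace_eq_zero_of_irrational_radical K (β i) (div_pos (hα i) (hα j)) hn (q := q / r) _
      (hirr i j hij), mul_zero]
    change (α i / α j) ^ n = _
    rw [div_pow, hq1, hr1]; push_cast; rfl
  · simp

end Radicals

/-! ### Weyl equidistribution on the torus. -/

section Equidistribution

open MeasureTheory UnitAddTorus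

instance isProbabilityMeasure_volume_unitAddCircle :
    IsProbabilityMeasure (volume : Measure UnitAddCircle) :=
  ⟨by simp⟩

instance nullSingletonClass_volume_unitAddCircle :
    NullSingletonClass (volume : Measure UnitAddCircle) := by
  refine ⟨fun x => ?_⟩
  have := AddCircle.volume_closedBall 1 (x := x) 0
  simpa [Metric.closedBall_zero] using this

lemma integral_fourier_eq_zero {n : ℤ} (hn : n ≠ 0) :
    ∫ t : UnitAddCircle, fourier n t = 0 :=
  integral_eq_zero_of_add_right_eq_neg (fourier_add_half_inv_index hn one_pos)

lemma integral_mFourier_eq_zero {ι : Type*} [Fintype ι] {m : ι → ℤ} (hm : m ≠ 0) :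
    ∫ t : UnitAddTorus ι, mFourier m t = 0 := by
  rw [mFourier, ContinuousMap.coe_mk, integral_fintype_prod_volume_eq_prod]
  obtain ⟨i, hi⟩ := Function.ne_iff.mp hm
  exact Finset.prod_eq_zero (Finset.mem_univ i) (integral_fourier_eq_zero hi)

/-- The average of the powers of a complex number `z ≠ 1` of modulus one tends to zero. -/
lemma tendsto_average_pow_of_norm_eq_one {z : ℂ} (hz : ‖z‖ = 1) (hz1 : z ≠ 1) :
    Tendsto (fun N : ℕ => ((N : ℂ) + 1)⁻¹ * ∑ n ∈ Finset.range (N + 1), z ^ n) atTop (𝓝 0) := by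
  have hz2 : z - 1 ≠ 0 := sub_ne_zero.2 hz1
  apply squeeze_zero_norm (a := fun N : ℕ => (1 / ((N : ℝ) + 1)) * (2 / ‖z - 1‖))
  · intro N
    rw [geom_sum_eq hz1, norm_mul, norm_inv, norm_div, one_div]
    have h1 : ‖(N : ℂ) + 1‖ = (N : ℝ) + 1 := by
      have : (N : ℂ) + 1 = ((N + 1 : ℕ) : ℂ) := by push_cast; rfl
      rw [this, Complex.norm_natCast]; push_cast; rfl
    rw [h1]
    gcongr
    calc ‖z ^ (N + 1) - 1‖ ≤ ‖z ^ (N + 1)‖ + ‖(1 : ℂ)‖ := norm_sub_le _ _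
      _ = 2 := by rw [norm_pow, hz]; norm_num
  · simpa using tendsto_one_div_add_atTop_nhds_zero_nat.mul_const (2 / ‖z - 1‖)

variable {ι : Type*} [Fintype ι]

/-- The point `n θ` of the torus. -/
def torusOrbit (θ : ι → ℝ) (n : ℕ) : UnitAddTorus ι := fun i => ((n * θ i : ℝ) : UnitAddCircle)

lemma mFourier_torusOrbit (θ : ι → ℝ) (m : ι → ℤ) (n : ℕ) :
    mFourier m (torusOrbit θ n) =
      Complex.exp ((2 * Real.pi * ∑ i, m i * θ i : ℝ) * Complex.I) ^ n := by
  simp only [mFourier, torusOrbit, ContinuousMap.coe_mk, fourier_coe_apply]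
  rw [← Complex.exp_sum, ← Complex.exp_nat_mul]
  congr 1
  push_cast
  rw [Finset.mul_sum, Finset.sum_mul, Finset.mul_sum]
  refine Finset.sum_congr rfl fun i _ => ?_
  ring

/-- Along the orbit a character runs through the powers of one number of modulus one, which differs
from `1` by independence when `m ≠ 0`; the geometric sum stays bounded. -/
lemma tendsto_average_mFourier {θ : ι → ℝ} (hθ : ∀ m : ι → ℤ, m ≠ 0 → ∀ a : ℤ, ∑ i, m i * θ i ≠ a)
    (m : ι → ℤ) :
    Tendsto (fun N : ℕ => ((N : ℂ) + 1)⁻¹ *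
      ∑ n ∈ Finset.range (N + 1), mFourier m (torusOrbit θ n)) atTop
      (𝓝 (∫ t : UnitAddTorus ι, mFourier m t)) := by
  by_cases hm : m = 0
  · subst hm
    have h : ∀ N : ℕ, ((N : ℂ) + 1)⁻¹ *
        ∑ n ∈ Finset.range (N + 1), mFourier (0 : ι → ℤ) (torusOrbit θ n) = 1 := by
      intro N
      have : (N : ℂ) + 1 ≠ 0 := Nat.cast_add_one_ne_zero N
      simp [mFourier_zero, this]
    simp_rw [h]
    simp [mFourier_zero]
  · rw [integral_mFourier_eq_zero hm]
    simp_rw [mFourier_torusOrbit]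
    apply tendsto_average_pow_of_norm_eq_one (Complex.norm_exp_ofReal_mul_I _)
    intro h
    rw [Complex.exp_eq_one_iff] at h
    obtain ⟨a, ha⟩ := h
    apply hθ m hm a
    have h2 : (2 * Real.pi * ∑ i, m i * θ i : ℝ) = 2 * Real.pi * a := by
      have h3 : (((2 * Real.pi * ∑ i, m i * θ i : ℝ) : ℂ)) * Complex.I =
          ((2 * Real.pi * a : ℝ) : ℂ) * Complex.I := by
        rw [ha]; push_cast; ring
      exact_mod_cast mul_right_cancel₀ Complex.I_ne_zero h3
    exact mul_left_cancel₀ (by positivity) h2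

/-- **Weyl's equidistribution theorem** on the torus, for continuous functions. -/
lemma tendsto_average_continuous {θ : ι → ℝ} (hθ : ∀ m : ι → ℤ, m ≠ 0 → ∀ a : ℤ, ∑ i, m i * θ i ≠ a)
    (f : C(UnitAddTorus ι, ℂ)) :
    Tendsto (fun N : ℕ => ((N : ℂ) + 1)⁻¹ *
      ∑ n ∈ Finset.range (N + 1), f (torusOrbit θ n)) atTop
      (𝓝 (∫ t : UnitAddTorus ι, f t)) := by
  have hint : ∀ g : C(UnitAddTorus ι, ℂ), Integrable (fun t => g t) volume := fun g =>
    g.continuous.integrable_of_hasCompactSupport (HasCompactSupport.of_compactSpace _)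
  have hspan : ∀ g ∈ Submodule.span ℂ (Set.range (mFourier (d := ι))),
      Tendsto (fun N : ℕ => ((N : ℂ) + 1)⁻¹ *
        ∑ n ∈ Finset.range (N + 1), g (torusOrbit θ n)) atTop
        (𝓝 (∫ t : UnitAddTorus ι, g t)) := by
    intro g hg
    induction hg using Submodule.span_induction with
    | mem g hg => obtain ⟨m, rfl⟩ := hg; exact tendsto_average_mFourier hθ m
    | zero => simp
    | add g h _ _ hg hh =>
      have := hg.add hh
      simp only [ContinuousMap.add_apply, Finset.sum_add_distrib, mul_add]
      rwa [integral_add (hint g) (hint h)]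
    | smul a g _ hg =>
      have := hg.const_mul a
      simp only [ContinuousMap.smul_apply, smul_eq_mul, ← Finset.mul_sum]
      rw [integral_const_mul]
      refine this.congr fun N => ?_
      ring
  have hf : f ∈ (Submodule.span ℂ (Set.range (mFourier (d := ι)))).topologicalClosure := by
    rw [span_mFourier_closure_eq_top]; trivial
  rw [Metric.tendsto_atTop]
  intro ε hε
  obtain ⟨g, hg, hfg⟩ := Metric.mem_closure_iff.1 hf (ε / 3) (by positivity)
  obtain ⟨N₀, hN₀⟩ := Metric.tendsto_atTop.1 (hspan g hg) (ε / 3) (by positivity)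
  have hpt : ∀ t, ‖f t - g t‖ ≤ ε / 3 := fun t => by
    rw [← dist_eq_norm]; exact (ContinuousMap.dist_apply_le_dist t).trans hfg.le
  refine ⟨N₀, fun N hN => ?_⟩
  have h1 : dist (((N : ℂ) + 1)⁻¹ * ∑ n ∈ Finset.range (N + 1), f (torusOrbit θ n))
      (((N : ℂ) + 1)⁻¹ * ∑ n ∈ Finset.range (N + 1), g (torusOrbit θ n)) ≤ ε / 3 := by
    rw [dist_eq_norm, ← mul_sub, ← Finset.sum_sub_distrib, norm_mul, norm_inv]
    have h1 : ‖(N : ℂ) + 1‖ = (N : ℝ) + 1 := by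
      have : (N : ℂ) + 1 = ((N + 1 : ℕ) : ℂ) := by push_cast; rfl
      rw [this, Complex.norm_natCast]; push_cast; rfl
    rw [h1, inv_mul_le_iff₀ (by positivity)]
    refine (norm_sum_le_of_le _ fun n _ => hpt _).trans ?_
    simp
  have h2 : dist (∫ t : UnitAddTorus ι, g t) (∫ t : UnitAddTorus ι, f t) ≤ ε / 3 := by
    rw [dist_comm, dist_eq_norm, ← integral_sub (hint f) (hint g)]
    refine (norm_integral_le_of_norm_le_const (Eventually.of_forall hpt)).trans ?_
    simp
  have h3 := hN₀ N hN
  have h4 := dist_triangle4 (((N : ℂ) + 1)⁻¹ * ∑ n ∈ Finset.range (N + 1), f (torusOrbit θ n))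
    (((N : ℂ) + 1)⁻¹ * ∑ n ∈ Finset.range (N + 1), g (torusOrbit θ n))
    (∫ t : UnitAddTorus ι, g t) (∫ t : UnitAddTorus ι, f t)
  linarith

/-- The closed arc `[0, c]` of the unit circle. -/
def arc (c : ℝ) : Set UnitAddCircle := (fun t : ℝ => (t : UnitAddCircle)) '' Set.Icc 0 c

lemma coe_mem_arc {c : ℝ} (hc : c < 1) (t : ℝ) : (t : UnitAddCircle) ∈ arc c ↔ Int.fract t ≤ c := by
  constructor
  · rintro ⟨s, ⟨h0, h1⟩, h⟩
    have h2 := AddCircle.coe_eq_coe_iff_of_mem_Ico (p := (1 : ℝ)) (a := 0) (x := s)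
      (y := Int.fract t) ⟨h0, by linarith⟩ ⟨Int.fract_nonneg t, by simpa using Int.fract_lt_one t⟩
    rw [AddCircle.coe_fract] at h2
    rw [← h2.1 h]; exact h1
  · intro h
    exact ⟨Int.fract t, ⟨Int.fract_nonneg t, h⟩, AddCircle.coe_fract t⟩

lemma isClosed_arc (c : ℝ) : IsClosed (arc c) :=
  (isCompact_Icc.image (AddCircle.continuous_mk' 1)).isClosed

lemma volume_arc {c : ℝ} (hc0 : 0 ≤ c) (hc : c < 1) : volume (arc c) = ENNReal.ofReal c := by
  rw [AddCircle.add_projection_respects_measure 1 0 (isClosed_arc c).measurableSet]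
  -- In the fundamental domain `(0, 1]` the point `0` of the circle is represented by `1`.
  have : QuotientAddGroup.mk ⁻¹' (arc c) ∩ Set.Ioc (0 : ℝ) (0 + 1) = insert 1 (Set.Ioc 0 c) := by
    ext t
    have h := coe_mem_arc hc t
    simp only [Set.mem_inter_iff, Set.mem_preimage, Set.mem_Ioc, Set.mem_insert_iff, zero_add]
    rw [show (QuotientAddGroup.mk t ∈ arc c) = ((t : UnitAddCircle) ∈ arc c) from rfl, h]
    constructor
    · rintro ⟨h1, h2, h3⟩
      rcases h3.eq_or_lt with h4 | h4
      · exact Or.inl h4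
      · rw [Int.fract_eq_self.2 ⟨h2.le, h4⟩] at h1
        exact Or.inr ⟨h2, h1⟩
    · rintro (rfl | ⟨h1, h2⟩)
      · simp [hc0]
      · refine ⟨?_, h1, by linarith⟩
        rwa [Int.fract_eq_self.2 ⟨h1.le, by linarith⟩]
  rw [this, measure_congr (insert_ae_eq_self 1 _), Real.volume_Ioc, sub_zero]

/-- The covering map is open, so a point all of whose coordinates avoid the arc endpoints is
interior. The boundary thus lies in finitely many null slices. Weak convergence of measures needs
this to yield convergence on boxes. -/
lemma volume_frontier_pi_arc (c : ι → ℝ) :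
    volume (frontier (Set.univ.pi fun i => arc (c i))) = 0 := by
  have hclosed : IsClosed (Set.univ.pi fun i => arc (c i)) :=
    isClosed_set_pi fun i _ => isClosed_arc (c i)
  have hsub : frontier (Set.univ.pi fun i => arc (c i)) ⊆
      ⋃ i, Function.eval i ⁻¹' ({((0 : ℝ) : UnitAddCircle), (c i : UnitAddCircle)}) := by
    intro y hy
    by_contra hcon
    simp only [Set.mem_iUnion, not_exists] at hcon
    rw [hclosed.frontier_eq] at hy
    refine hy.2 (mem_interior.2 ⟨Set.univ.pi fun i =>
      (fun t : ℝ => (t : UnitAddCircle)) '' Set.Ioo 0 (c i), ?_, ?_, ?_⟩)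
    · exact Set.pi_mono fun i _ => Set.image_mono Set.Ioo_subset_Icc_self
    · exact isOpen_set_pi Set.finite_univ fun i _ =>
        QuotientAddGroup.isOpenMap_coe _ isOpen_Ioo
    · intro i _
      obtain ⟨t, ⟨h0, h1⟩, ht⟩ := hy.1 i trivial
      have hi := hcon i
      simp only [Set.mem_preimage, Function.eval, Set.mem_insert_iff, Set.mem_singleton_iff,
        not_or] at hi
      refine ⟨t, ⟨h0.lt_of_ne ?_, h1.lt_of_ne ?_⟩, ht⟩
      · rintro rfl; exact hi.1 ht.symm
      · rintro rfl; exact hi.2 ht.symm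
  refine measure_mono_null hsub (measure_iUnion_null fun i => ?_)
  rw [volume_pi, (measurePreserving_eval (fun _ : ι => (volume : Measure UnitAddCircle)) i).measure_preimage]
  · exact (Set.toFinite _).measure_zero _
  · exact ((Set.toFinite _).measurableSet).nullMeasurableSet

/-- The uniform probability measure on the first `N + 1` points of a sequence. -/
noncomputable def empiricalMeasure {X : Type*} [MeasurableSpace X] (x : ℕ → X) (N : ℕ) :
    Measure X :=
  ((N : ENNReal) + 1)⁻¹ • ∑ n ∈ Finset.range (N + 1), Measure.dirac (x n)

lemma isProbabilityMeasure_empiricalMeasure {X : Type*} [MeasurableSpace X] (x : ℕ → X) (N : ℕ) :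
    IsProbabilityMeasure (empiricalMeasure x N) := by
  refine ⟨?_⟩
  simp only [empiricalMeasure, Measure.smul_apply, Measure.coe_finsetSum, Finset.sum_apply,
    measure_univ, Finset.sum_const, Finset.card_range, smul_eq_mul, nsmul_eq_mul, mul_one]
  push_cast
  exact ENNReal.inv_mul_cancel (by simp) (by simp)

/-- **Weyl's equidistribution theorem** for boxes. -/
theorem tendsto_card_fract_le {θ : ι → ℝ} (hθ : ∀ m : ι → ℤ, m ≠ 0 → ∀ a : ℤ, ∑ i, m i * θ i ≠ a)
    {c : ι → ℝ} (hc0 : ∀ i, 0 ≤ c i) (hc1 : ∀ i, c i < 1) :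
    Tendsto (fun N : ℕ => (((Finset.range (N + 1)).filter fun n : ℕ =>
      ∀ i, Int.fract (n * θ i) ≤ c i).card : ℝ) / ((N : ℝ) + 1)) atTop (𝓝 (∏ i, c i)) := by
  classical
  let μs : ℕ → ProbabilityMeasure (UnitAddTorus ι) := fun N =>
    ⟨empiricalMeasure (torusOrbit θ) N, isProbabilityMeasure_empiricalMeasure _ N⟩
  let μ : ProbabilityMeasure (UnitAddTorus ι) := ⟨volume, inferInstance⟩
  have hlim : Tendsto μs atTop (𝓝 μ) := by
    rw [ProbabilityMeasure.tendsto_iff_forall_integral_rclike_tendsto ℂ]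
    intro f
    refine (tendsto_average_continuous hθ f.toContinuousMap).congr fun N => ?_
    change _ = ∫ t, f t ∂(empiricalMeasure (torusOrbit θ) N)
    rw [empiricalMeasure, integral_smul_measure, integral_finsetSum_measure]
    · simp only [integral_dirac]
      have h : (((N : ENNReal) + 1)⁻¹).toReal = ((N : ℝ) + 1)⁻¹ := by
        rw [ENNReal.toReal_inv, ENNReal.toReal_add (ENNReal.natCast_ne_top N) ENNReal.one_ne_top]
        simp
      rw [h, Complex.real_smul]
      push_cast
      rfl
    · intro n _
      exact integrable_dirac (by simp)
  have hmain := ProbabilityMeasure.tendsto_measure_of_null_frontier_of_tendsto' hlim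
    (E := Set.univ.pi fun i => arc (c i)) (volume_frontier_pi_arc c)
  have hvol : (μ : Measure (UnitAddTorus ι)) (Set.univ.pi fun i => arc (c i)) =
      ENNReal.ofReal (∏ i, c i) := by
    change volume _ = _
    rw [volume_pi_pi, ENNReal.ofReal_prod_of_nonneg fun i _ => hc0 i]
    exact Finset.prod_congr rfl fun i _ => volume_arc (hc0 i) (hc1 i)
  rw [hvol] at hmain
  have hreal := (ENNReal.tendsto_toReal ENNReal.ofReal_ne_top).comp hmain
  rw [ENNReal.toReal_ofReal (Finset.prod_nonneg fun i _ => hc0 i)] at hreal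
  refine hreal.congr fun N => ?_
  change ((empiricalMeasure (torusOrbit θ) N) (Set.univ.pi fun i => arc (c i))).toReal = _
  have hmeas : MeasurableSet (Set.univ.pi fun i => arc (c i)) :=
    (isClosed_set_pi fun i _ => isClosed_arc (c i)).measurableSet
  have hmem : ∀ n, torusOrbit θ n ∈ (Set.univ.pi fun i => arc (c i)) ↔
      ∀ i, Int.fract (n * θ i) ≤ c i := by
    intro n
    simp only [Set.mem_univ_pi, torusOrbit]
    exact forall_congr' fun i => coe_mem_arc (hc1 i) _
  simp only [empiricalMeasure, Measure.smul_apply, Measure.coe_finsetSum, Finset.sum_apply,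
    Measure.dirac_apply' _ hmeas, smul_eq_mul, Set.indicator_apply, hmem, Pi.one_apply]
  rw [Finset.sum_boole, ENNReal.toReal_mul, ENNReal.toReal_inv, div_eq_inv_mul]
  congr 1

end Equidistribution

/-! ### Structure of `k`-full numbers and independence of the numbers `1 / l`. -/

section Arithmetic

/-- Positive integers all of whose prime exponents are `0` or lie strictly between `k` and `2 * k`. -/
def IsKernel (k N : ℕ) : Prop :=
  N ≠ 0 ∧ ∀ p, N.factorization p = 0 ∨ (k < N.factorization p ∧ N.factorization p < 2 * k)

lemma isKernel_one (k : ℕ) : IsKernel k 1 := ⟨one_ne_zero, fun p => Or.inl (by simp)⟩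

/-- Kernels are determined by their class modulo `k`-th powers. -/
lemma IsKernel.eq_of_pow_mul_eq {k M N u v : ℕ} (hM : IsKernel k M) (hN : IsKernel k N)
    (hu : u ≠ 0) (hv : v ≠ 0) (h : u ^ k * M = v ^ k * N) : M = N := by
  apply Nat.eq_of_factorization_eq hM.1 hN.1
  intro p
  have h1 := congrArg (fun m => m.factorization p) h
  simp only [Nat.factorization_mul (pow_ne_zero k hu) hM.1,
    Nat.factorization_mul (pow_ne_zero k hv) hN.1, Nat.factorization_pow, Finsupp.add_apply,
    Finsupp.smul_apply, smul_eq_mul] at h1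
  set a := u.factorization p
  set b := v.factorization p
  -- The allowed exponents form a set of distinct residues modulo `k`: a difference of `k` would
  -- need `x = k` or `x > 2 * k`, and larger multiples are out of range.
  have key : ∀ x y s t : ℕ, k * s + x = k * t + y → (x = 0 ∨ k < x ∧ x < 2 * k) →
      (y = 0 ∨ k < y ∧ y < 2 * k) → s ≤ t → x = y := by
    intro x y s t h hx hy hst
    obtain ⟨e, rfl⟩ := Nat.exists_eq_add_of_le hst
    have h2 : x = k * e + y := by rw [mul_add] at h; omega
    rcases Nat.lt_or_ge e 1 with he | he
    · obtain rfl : e = 0 := by omega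
      simpa using h2
    · rcases Nat.lt_or_ge e 2 with he2 | he2
      · obtain rfl : e = 1 := by omega
        omega
      · have : k * 2 ≤ k * e := Nat.mul_le_mul_left k he2
        omega
  rcases le_total a b with hab | hab
  · exact key _ _ _ _ h1 (hM.2 p) (hN.2 p) hab
  · exact (key _ _ _ _ h1.symm (hN.2 p) (hM.2 p) hab).symm

/-- Squarefreeness of the product lets each prime divide at most one `b i`, and only once, so its
exponent is `0` or a single `k + 1 + i < 2 * k`. -/
lemma isKernel_prod {k : ℕ} (b : Fin (k - 1) → ℕ) (hsq : Squarefree (∏ i, b i)) :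
    IsKernel k (∏ i, b i ^ (k + 1 + (i : ℕ))) := by
  have h0 : ∀ i, b i ≠ 0 := fun i hi => hsq.ne_zero (Finset.prod_eq_zero (Finset.mem_univ i) hi)
  refine ⟨Finset.prod_ne_zero_iff.2 fun i _ => pow_ne_zero _ (h0 i), fun p => ?_⟩
  have h1 : ∑ i, (b i).factorization p ≤ 1 := by
    have := hsq.natFactorization_le_one p
    rwa [Nat.factorization_prod fun i _ => h0 i, Finset.sum_apply'] at this
  rw [Nat.factorization_prod fun i _ => pow_ne_zero _ (h0 i), Finset.sum_apply']
  simp only [Nat.factorization_pow, Finsupp.smul_apply, smul_eq_mul]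
  by_cases hall : ∀ i, (b i).factorization p = 0
  · left; simp [hall]
  · right
    push Not at hall
    obtain ⟨i, hi⟩ := hall
    have hle : ∀ j, (b j).factorization p ≤ ∑ i, (b i).factorization p := fun j =>
      Finset.single_le_sum (f := fun i => (b i).factorization p) (fun _ _ => Nat.zero_le _)
        (Finset.mem_univ j)
    have hother : ∀ j, j ≠ i → (b j).factorization p = 0 := by
      intro j hj
      have := Finset.add_le_sum (f := fun i => (b i).factorization p) (fun _ _ => Nat.zero_le _)
        (Finset.mem_univ i) (Finset.mem_univ j) hj.symm
      omega
    have hi1 : (b i).factorization p = 1 := by have := hle i; omega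
    rw [Finset.sum_eq_single i (fun j _ hj => by rw [hother j hj, mul_zero]) (by simp), hi1]
    have := i.2
    omega

/-- Every element of `Lambda k` is the `k`-th root of a kernel different from `1`. -/
lemma exists_isKernel_of_mem_Lambda {k : ℕ} {l : ℝ} (hl : l ∈ Lambda k) :
    ∃ N : ℕ, IsKernel k N ∧ N ≠ 1 ∧ l = (N : ℝ) ^ ((1 : ℝ) / k) := by
  obtain ⟨b, hb1, hb2, hb3, rfl⟩ := hl
  refine ⟨∏ i, b i ^ (k + 1 + (i : ℕ)), isKernel_prod b hb3, ?_, by push_cast; rfl⟩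
  intro h
  have h1 : ∀ i, b i = 1 := by
    intro i
    have := (Finset.prod_eq_one_iff_of_one_le' fun i _ => Nat.one_le_pow _ _ (hb1 i)).1 h i
      (Finset.mem_univ i)
    exact (Nat.pow_eq_one.1 this).resolve_right (by omega)
  simp [h1] at hb2

/-- A `k`-full number is a `k`-th power times `∏ bᵢ ^ (k + i)` with squarefree `∏ bᵢ`. -/
lemma IsFull.exists_decomposition {k m : ℕ} (hk : 2 ≤ k) (hm : IsFull k m) :
    ∃ (a : ℕ) (b : Fin (k - 1) → ℕ), 1 ≤ a ∧ (∀ i, 1 ≤ b i) ∧ Squarefree (∏ i, b i) ∧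
      m = a ^ k * ∏ i, b i ^ (k + 1 + (i : ℕ)) := by
  have hm0 : m ≠ 0 := hm.1.ne'
  set v := m.factorization with hv
  have hvk : ∀ p ∈ m.primeFactors, k ≤ v p := by
    intro p hp
    rw [Nat.mem_primeFactors] at hp
    exact (hp.1.pow_dvd_iff_le_factorization hm0).1 (hm.2 p hp.1 hp.2.1)
  -- An exponent `v = k * q + r` with `0 < r < k` is split as `k * (q - 1) + (k + r)`, which is
  -- possible because fullness gives `q ≥ 1`; the prime then goes into the factor with index `r -
  -- 1`.
  let e : ℕ → ℕ := fun p => if v p % k = 0 then v p / k else v p / k - 1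
  let b : Fin (k - 1) → ℕ := fun i => ∏ p ∈ m.primeFactors with v p % k = i + 1, p
  have hpos : ∀ p ∈ m.primeFactors, 1 ≤ p := fun p hp => (Nat.prime_of_mem_primeFactors hp).one_le
  -- a product over the indices `i` collapses to the single index attached to each prime
  have hcollapse : ∀ f : ℕ → ℕ → ℕ, (∏ i : Fin (k - 1),
      ∏ p ∈ m.primeFactors with v p % k = i + 1, f p i) =
      ∏ p ∈ m.primeFactors, if v p % k = 0 then 1 else f p (v p % k - 1) := by
    intro f
    simp_rw [Finset.prod_filter]
    rw [Finset.prod_comm]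
    refine Finset.prod_congr rfl fun p _ => ?_
    have hlt : v p % k < k := Nat.mod_lt _ (by omega)
    split_ifs with h0
    · refine Finset.prod_eq_one fun i _ => if_neg (by omega)
    · rw [Finset.prod_eq_single (⟨v p % k - 1, by omega⟩ : Fin (k - 1))]
      · rw [if_pos]; simp only; omega
      · intro i _ hi
        refine if_neg fun h => hi (Fin.ext ?_)
        simp only; omega
      · simp
  refine ⟨∏ p ∈ m.primeFactors, p ^ e p, b, ?_, ?_, ?_, ?_⟩
  · exact Finset.one_le_prod' fun p hp => Nat.one_le_pow _ _ (hpos p hp)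
  · exact fun i => Finset.one_le_prod' fun p hp => hpos p (Finset.mem_filter.1 hp).1
  · rw [hcollapse fun p _ => p]
    have : (∏ p ∈ m.primeFactors, if v p % k = 0 then 1 else p) ∣ ∏ p ∈ m.primeFactors, p :=
      Finset.prod_dvd_prod_of_dvd _ _ fun p _ => by split_ifs <;> simp
    refine Squarefree.squarefree_of_dvd this
      (Finset.squarefree_prod_of_pairwise_isCoprime ?_ fun p hp =>
        (Nat.prime_of_mem_primeFactors hp).squarefree)
    intro p hp q hq hpq
    exact Nat.coprime_iff_isRelPrime.1 ((Nat.coprime_primes (Nat.prime_of_mem_primeFactors hp)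
      (Nat.prime_of_mem_primeFactors hq)).2 hpq)
  · have h2 : ∏ i, b i ^ (k + 1 + (i : ℕ)) =
        ∏ p ∈ m.primeFactors, if v p % k = 0 then 1 else p ^ (k + 1 + (v p % k - 1)) := by
      rw [← hcollapse fun p i => p ^ (k + 1 + i)]
      exact Finset.prod_congr rfl fun i _ => (Finset.prod_pow _ _ _).symm
    rw [h2, ← Finset.prod_pow, ← Finset.prod_mul_distrib]
    conv_lhs => rw [← Nat.prod_factorization_pow_eq_self hm0]
    rw [Finsupp.prod, Nat.support_factorization]
    refine Finset.prod_congr rfl fun p hp => ?_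
    have hdm := Nat.div_add_mod (v p) k
    have hge : 1 ≤ v p / k := (Nat.one_le_div_iff (by omega)).2 (hvk p hp)
    simp only [e]
    split_ifs with h0
    · rw [mul_one, ← pow_mul, mul_comm (v p / k), ← hv]
      congr 1; omega
    · rw [← pow_mul, ← pow_add, ← hv]
      congr 1
      obtain ⟨d, hd⟩ := Nat.exists_eq_add_of_le hge
      rw [hd] at hdm ⊢
      have : (1 + d - 1) * k = k * d := by rw [Nat.add_sub_cancel_left, mul_comm]
      rw [this]
      rw [mul_add] at hdm
      omega

lemma IsKernel.mul_pow_mem_S {k a N : ℕ} (hN : IsKernel k N) (hN1 : N ≠ 1) (hk : 2 ≤ k)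
    (ha : 1 ≤ a) : a ^ k * N ∈ S k := by
  have ha0 : a ≠ 0 := by omega
  refine ⟨⟨Nat.pos_of_ne_zero (mul_ne_zero (pow_ne_zero _ ha0) hN.1), ?_⟩, ?_⟩
  · intro p hp hdvd
    rcases hp.dvd_mul.1 hdvd with h | h
    · exact (pow_dvd_pow_of_dvd (hp.dvd_of_dvd_pow h) k).mul_right N
    · refine Dvd.dvd.mul_left ?_ _
      rw [hp.pow_dvd_iff_le_factorization hN.1]
      have := (hp.dvd_iff_one_le_factorization hN.1).1 h
      rcases hN.2 p with h | h <;> omega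
  · rintro ⟨c, hc⟩
    have hc0 : c ≠ 0 := by
      rintro rfl
      rw [zero_pow (by omega)] at hc
      exact mul_ne_zero (pow_ne_zero _ ha0) hN.1 hc
    exact hN1 (hN.eq_of_pow_mul_eq (isKernel_one k) ha0 hc0 (by rw [hc, mul_one]))

lemma Lambda_pos {k : ℕ} {l : ℝ} (hl : l ∈ Lambda k) : 0 < l := by
  obtain ⟨N, hN, -, rfl⟩ := exists_isKernel_of_mem_Lambda hl
  have := Nat.pos_of_ne_zero hN.1
  positivity

/-- A kernel other than `1` is divisible by some `p ^ (k + 1)`, hence exceeds `2 ^ k`. This makes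
every factor `1 - 2 / l` positive. -/
lemma two_lt_of_mem_Lambda {k : ℕ} (hk : 2 ≤ k) {l : ℝ} (hl : l ∈ Lambda k) : 2 < l := by
  obtain ⟨N, hN, hN1, rfl⟩ := exists_isKernel_of_mem_Lambda hl
  have hk0 : (0 : ℝ) < k := by positivity
  have h : 2 ^ (k + 1) ≤ N := by
    obtain ⟨p, hp, hpN⟩ := Nat.exists_prime_and_dvd hN1
    have h1 := (hp.dvd_iff_one_le_factorization hN.1).1 hpN
    have h2 : k + 1 ≤ N.factorization p := by rcases hN.2 p with h | h <;> omega
    calc 2 ^ (k + 1) ≤ p ^ (k + 1) := Nat.pow_le_pow_left hp.two_le _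
      _ ≤ N := Nat.le_of_dvd (Nat.pos_of_ne_zero hN.1)
        ((hp.pow_dvd_iff_le_factorization hN.1).2 h2)
  rw [one_div, Real.lt_rpow_inv_iff_of_pos (by norm_num) (by positivity) hk0, Real.rpow_natCast]
  have h3 : (2 : ℝ) ^ (k + 1) ≤ N := by exact_mod_cast h
  have h4 : (0 : ℝ) < 2 ^ k := by positivity
  rw [pow_succ] at h3
  linarith

lemma mul_root_pow {k a N : ℕ} (hk : k ≠ 0) :
    ((a : ℝ) * (N : ℝ) ^ ((1 : ℝ) / k)) ^ k = ((a ^ k * N : ℕ) : ℝ) := by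
  rw [mul_pow, one_div, Real.rpow_inv_natCast_pow (by positivity) hk]
  push_cast; rfl

/-- `S k` is the set of `k`-th powers of positive multiples of elements of `Lambda k`. -/
lemma mem_S_iff {k : ℕ} (hk : 2 ≤ k) (m : ℕ) :
    m ∈ S k ↔ ∃ l ∈ Lambda k, ∃ a : ℕ, 1 ≤ a ∧ (a * l) ^ k = (m : ℝ) := by
  constructor
  · rintro ⟨hfull, hpow⟩
    obtain ⟨a, b, ha, hb, hsq, hm⟩ := hfull.exists_decomposition hk
    refine ⟨_, ⟨b, hb, ?_, hsq, rfl⟩, a, ha, ?_⟩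
    · by_contra hlt
      have h1 : 1 ≤ ∏ i, b i := Finset.one_le_prod' fun i _ => hb i
      have h2 : ∏ i, b i = 1 := by omega
      have h3 := (Finset.prod_eq_one_iff_of_one_le' fun i _ => hb i).1 h2
      apply hpow
      refine ⟨a, ?_⟩
      rw [hm, Finset.prod_eq_one fun i hi => by rw [h3 i hi, one_pow], mul_one]
    · rw [hm, ← mul_root_pow (by omega)]
      push_cast; rfl
  · rintro ⟨l, hl, a, ha, h⟩
    obtain ⟨N, hN, hN1, rfl⟩ := exists_isKernel_of_mem_Lambda hl
    rw [mul_root_pow (by omega)] at h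
    rw [← Nat.cast_injective h]
    exact hN.mul_pow_mem_S hN1 hk ha

lemma mem_B_iff {k : ℕ} (hk : 2 ≤ k) (n : ℕ) :
    n ∈ B k ↔ 1 ≤ n ∧ ∀ l ∈ Lambda k, ∀ a : ℕ, ¬ ((n : ℝ) < a * l ∧ a * l < n + 2) := by
  have hk0 : k ≠ 0 := by omega
  refine and_congr_right fun hn => ?_
  rw [Set.eq_empty_iff_forall_notMem]
  constructor
  · rintro h l hl a ⟨h1, h2⟩
    have hl0 := Lambda_pos hl
    have ha : 1 ≤ a := by
      rcases Nat.eq_zero_or_pos a with rfl | ha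
      · have : (0 : ℝ) ≤ n := by positivity
        simp at h1; linarith
      · exact ha
    obtain ⟨N, hN, hN1, rfl⟩ := exists_isKernel_of_mem_Lambda hl
    refine h (a ^ k * N) ⟨⟨?_, ?_⟩, hN.mul_pow_mem_S hN1 hk ha⟩
    · have := pow_lt_pow_left₀ h1 (by positivity) hk0
      rw [mul_root_pow hk0] at this
      exact_mod_cast this
    · have := pow_lt_pow_left₀ h2 (by positivity) hk0
      rw [mul_root_pow hk0] at this
      exact_mod_cast this
  · rintro h m ⟨⟨h1, h2⟩, hm⟩
    obtain ⟨l, hl, a, ha, hal⟩ := (mem_S_iff hk m).1 hm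
    have hl0 := Lambda_pos hl
    refine h l hl a ⟨lt_of_pow_lt_pow_left₀ k (by positivity) ?_,
      lt_of_pow_lt_pow_left₀ k (by positivity) ?_⟩
    · rw [hal]; exact_mod_cast h1
    · rw [hal]; exact_mod_cast h2

/-- Quotients of `k`-th roots of distinct kernels are irrational. -/
lemma irrational_root_div_root {k M N : ℕ} (hk : 2 ≤ k) (hM : IsKernel k M) (hN : IsKernel k N)
    (hne : M ≠ N) : Irrational ((M : ℝ) ^ ((1 : ℝ) / k) / (N : ℝ) ^ ((1 : ℝ) / k)) := by
  rintro ⟨q, hq⟩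
  have hM0 : (0 : ℝ) < M := by exact_mod_cast Nat.pos_of_ne_zero hM.1
  have hN0 : (0 : ℝ) < N := by exact_mod_cast Nat.pos_of_ne_zero hN.1
  have hk0 : k ≠ 0 := by omega
  have hqpos : 0 < q := by
    have : (0 : ℝ) < q := by rw [hq]; positivity
    exact_mod_cast this
  have h1 : (q : ℝ) ^ k = M / N := by
    rw [hq, div_pow, one_div, Real.rpow_inv_natCast_pow hM0.le hk0,
      Real.rpow_inv_natCast_pow hN0.le hk0]
  have h2 : (q.den : ℝ) ^ k * M = (q.num.natAbs : ℝ) ^ k * N := by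
    have hden : (q.den : ℝ) ≠ 0 := by exact_mod_cast q.den_nz
    have hnum : (q : ℝ) = (q.num.natAbs : ℝ) / q.den := by
      have h3 : ((q.num.natAbs : ℤ) : ℝ) = (q.num : ℝ) := by
        rw [Int.natAbs_of_nonneg (Rat.num_pos.2 hqpos).le]
      rw [Int.cast_natCast] at h3
      rw [h3]; exact Rat.cast_def q
    rw [hnum, div_pow] at h1
    field_simp at h1
    linarith
  refine hne (hM.eq_of_pow_mul_eq hN q.den_nz ?_ (by exact_mod_cast h2))
  exact Int.natAbs_ne_zero.2 (Rat.num_pos.2 hqpos).ne'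

/-- The reciprocals of finitely many elements of `Lambda k` are rationally independent,
together with `1`. -/
lemma Lambda_inv_independent {k : ℕ} (hk : 2 ≤ k) (F : Finset (Lambda k)) (m : F → ℤ) (hm : m ≠ 0)
    (a : ℤ) : ∑ i, m i * (1 / ((i : Lambda k) : ℝ)) ≠ a := by
  intro h
  choose N hN hN1 hNl using fun l : Lambda k => exists_isKernel_of_mem_Lambda l.2
  have hk0 : k ≠ 0 := by omega
  -- The index `none` carries the kernel `1`, whose root is `1`, so that the integer `a` enters the
  -- relation as one more coefficient.
  let M : Option F → ℕ := fun o => o.elim 1 fun l => N l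
  have hM : ∀ o, IsKernel k (M o) := by
    rintro (_ | l)
    · exact isKernel_one k
    · exact hN l
  have hinj : Function.Injective M := by
    rintro (_ | l) (_ | l') hll
    · rfl
    · exact absurd hll.symm (hN1 l')
    · exact absurd hll (hN1 l)
    · have : (l : Lambda k) = l' := Subtype.ext (by
        rw [hNl l, hNl l']
        change N l = N l' at hll
        rw [hll])
      rw [Subtype.ext this]
  have hM0 : ∀ o, (0 : ℝ) < M o := fun o => by exact_mod_cast Nat.pos_of_ne_zero (hM o).1
  let α : Option F → ℝ := fun o => 1 / (M o : ℝ) ^ ((1 : ℝ) / k)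
  have hα : ∀ o, 0 < α o := fun o => by have := hM0 o; positivity
  have hq : ∀ o, ∃ q : ℚ, α o ^ k = q := fun o => ⟨1 / M o, by
    simp only [α]
    rw [div_pow, one_pow, one_div (k : ℝ), Real.rpow_inv_natCast_pow (hM0 o).le hk0]
    push_cast; rfl⟩
  have hirr : ∀ i j, i ≠ j → Irrational (α i / α j) := by
    intro i j hij
    have := irrational_root_div_root hk (hM j) (hM i) fun h => hij (hinj h.symm)
    simp only [α]
    rwa [div_div_div_eq, one_mul, mul_one]
  have hzero := linearIndependent_radicals α hα hk0 hq hirr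
    (fun o => o.elim (-(a : ℚ)) fun l => (m l : ℚ)) (by
      rw [Fintype.sum_option]
      simp only [Option.elim, α, M, Nat.cast_one, Real.one_rpow, div_one, mul_one]
      push_cast
      rw [← h, neg_add_eq_zero]
      exact Finset.sum_congr rfl fun l _ => by rw [← hNl])
  apply hm
  funext l
  have h1 : (m l : ℚ) = 0 := hzero (some l)
  exact_mod_cast h1

end Arithmetic

/-! ### From finitely many `l` to the density of `B k`. -/

section Density

/-- A finite product of summable nonnegative families is summable over the product index type. -/
lemma summable_pi_prod {ι : Type*} [Fintype ι] {f : ι → ℕ → ℝ} (h0 : ∀ i j, 0 ≤ f i j)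
    (hf : ∀ i, Summable (f i)) : Summable fun b : ι → ℕ => ∏ i, f i (b i) := by
  classical
  refine summable_of_sum_le (c := ∏ i, ∑' j, f i j) (fun b => Finset.prod_nonneg fun i _ => h0 _ _)
    fun s => ?_
  let t : ι → Finset ℕ := fun i => s.image fun b => b i
  calc ∑ b ∈ s, ∏ i, f i (b i) ≤ ∑ b ∈ Fintype.piFinset t, ∏ i, f i (b i) := by
        refine Finset.sum_le_sum_of_subset_of_nonneg ?_ fun b _ _ =>
          Finset.prod_nonneg fun i _ => h0 _ _
        intro b hb
        exact Fintype.mem_piFinset.2 fun i => Finset.mem_image_of_mem _ hb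
    _ = ∏ i, ∑ j ∈ t i, f i j := (Finset.prod_univ_sum t f).symm
    _ ≤ ∏ i, ∑' j, f i j := Finset.prod_le_prod (fun i _ => Finset.sum_nonneg fun j _ => h0 i j)
        fun i _ => (hf i).sum_le_tsum _ fun j _ => h0 i j

/-- The tuples `b` embed `Lambda k` in a product index set, over which the sum factors into
`p`-series with exponents `(k + 1 + i) / k > 1`. -/
lemma summable_one_div_Lambda {k : ℕ} (hk : 2 ≤ k) :
    Summable fun l : Lambda k => 1 / (l : ℝ) := by
  have hk0 : (0 : ℝ) < k := by positivity
  choose b hb1 hb2 hb3 hbl using fun l : Lambda k => l.2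
  have hinj : Function.Injective b := fun l l' h => Subtype.ext (by rw [hbl l, hbl l', h])
  have hs := (summable_pi_prod (ι := Fin (k - 1))
    (f := fun i j => 1 / (j : ℝ) ^ (((k + 1 + (i : ℕ) : ℕ) : ℝ) / k))
    (fun i j => by positivity) (fun i => Real.summable_one_div_nat_rpow.2 (by
      rw [lt_div_iff₀ hk0]; push_cast; have : (0 : ℝ) ≤ (i : ℕ) := by positivity
      linarith))).comp_injective hinj
  refine hs.congr fun l => ?_
  simp only [Function.comp]
  rw [hbl l, Finset.prod_div_distrib, Finset.prod_const_one,
    ← Real.finsetProd_rpow _ _ (fun i _ => by positivity)]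
  congr 1
  refine Finset.prod_congr rfl fun i _ => ?_
  rw [← Real.rpow_natCast, ← Real.rpow_mul (by positivity), mul_one_div]

lemma one_sub_two_div_pos {k : ℕ} (hk : 2 ≤ k) (l : Lambda k) : 0 < 1 - 2 / (l : ℝ) := by
  have h := two_lt_of_mem_Lambda hk l.2
  rw [sub_pos, div_lt_one (by linarith)]
  exact h

lemma summable_log_one_sub {k : ℕ} (hk : 2 ≤ k) :
    Summable fun l : Lambda k => Real.log (1 - 2 / (l : ℝ)) := by
  have := Real.summable_log_one_add_of_summable ((summable_one_div_Lambda hk).mul_left (-2))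
  refine this.congr fun l => ?_
  congr 1
  ring

lemma multipliable_one_sub {k : ℕ} (hk : 2 ≤ k) :
    Multipliable fun l : Lambda k => 1 - 2 / (l : ℝ) :=
  Real.multipliable_of_summable_log (one_sub_two_div_pos hk) (summable_log_one_sub hk)

lemma C_eq_exp {k : ℕ} (hk : 2 ≤ k) :
    C k = Real.exp (∑' l : Lambda k, Real.log (1 - 2 / (l : ℝ))) :=
  (Real.rexp_tsum_eq_tprod (one_sub_two_div_pos hk) (summable_log_one_sub hk)).symm

lemma C_pos {k : ℕ} (hk : 2 ≤ k) : 0 < C k := by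
  rw [C_eq_exp hk]; exact Real.exp_pos _

/-- No multiple of `l > 2` lies in `(n, n + 2)` iff the fractional part of `n / l` is at most
`1 - 2 / l`. -/
lemma forall_not_between_iff {l : ℝ} (hl : 2 < l) (n : ℕ) :
    (∀ a : ℕ, ¬ ((n : ℝ) < a * l ∧ a * l < n + 2)) ↔ Int.fract (n * (1 / l)) ≤ 1 - 2 / l := by
  have hl0 : 0 < l := by linarith
  set t : ℝ := n * (1 / l) with ht
  have htl : t * l = n := by rw [ht]; field_simp
  have ht0 : 0 ≤ t := by positivity
  have h2 : 2 / l * l = 2 := by field_simp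
  have hbetween : ∀ a : ℕ, ((n : ℝ) < a * l ∧ a * l < n + 2) ↔ (t < a ∧ a < t + 2 / l) := by
    intro a
    refine and_congr ?_ ?_
    · rw [← htl]; exact mul_lt_mul_iff_left₀ hl0
    · rw [← htl, show t * l + 2 = (t + 2 / l) * l by rw [add_mul, h2]]
      exact mul_lt_mul_iff_left₀ hl0
  simp_rw [hbetween]
  have hfl : ((⌊t⌋₊ : ℕ) : ℝ) = t - Int.fract t := by
    rw [natCast_floor_eq_intCast_floor ht0]; exact (Int.self_sub_fract t).symm
  constructor
  · intro h
    by_contra hcon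
    push Not at hcon
    refine h (⌊t⌋₊ + 1) ⟨?_, ?_⟩
    · push_cast; exact Nat.lt_floor_add_one t
    · push_cast; rw [hfl]; linarith
  · rintro h a ⟨h1, h3⟩
    have h4 : ⌊t⌋₊ + 1 ≤ a := (Nat.floor_lt ht0).2 h1
    have h5 : ((⌊t⌋₊ : ℕ) : ℝ) + 1 ≤ a := by exact_mod_cast h4
    rw [hfl] at h5
    linarith

/-- The positive integers `n` such that no multiple of an element of `F` lies in `(n, n + 2)`. -/
def avoiding {k : ℕ} (F : Finset (Lambda k)) : Set ℕ :=
  {n | 1 ≤ n ∧ ∀ l ∈ F, ∀ a : ℕ, ¬ ((n : ℝ) < a * (l : ℝ) ∧ a * (l : ℝ) < n + 2)}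

lemma finite_le (A : Set ℕ) (x : ℝ) : {n : ℕ | n ∈ A ∧ (n : ℝ) ≤ x}.Finite :=
  (Set.finite_Iic ⌊x⌋₊).subset fun _ hn => Nat.le_floor hn.2

lemma hasDensity_avoiding {k : ℕ} (hk : 2 ≤ k) (F : Finset (Lambda k)) :
    HasDensity (avoiding F) (∏ l ∈ F, (1 - 2 / (l : ℝ))) := by
  have hw := tendsto_card_fract_le (ι := F) (θ := fun i => 1 / ((i : Lambda k) : ℝ))
    (Lambda_inv_independent hk F) (c := fun i => 1 - 2 / ((i : Lambda k) : ℝ))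
    (fun i => (one_sub_two_div_pos hk i).le)
    (fun i => by have := Lambda_pos i.1.2; have : 0 < 2 / ((i : Lambda k) : ℝ) := by positivity
                 linarith)
  rw [← Finset.prod_coe_sort]
  set g : ℕ → ℕ := fun N => ((Finset.range (N + 1)).filter fun n : ℕ =>
      ∀ i : F, Int.fract (n * (1 / ((i : Lambda k) : ℝ))) ≤ 1 - 2 / ((i : Lambda k) : ℝ)).card with hg
  have hcount : ∀ x : ℝ, 0 ≤ x →
      -- The extra `1` is `n = 0`, which meets the fractional-part conditions but is excluded from
      -- `avoiding F`.
      {n : ℕ | n ∈ avoiding F ∧ (n : ℝ) ≤ x}.ncard + 1 = g ⌊x⌋₊ := by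
    intro x hx
    have h0 : (0 : ℕ) ∉ {n : ℕ | n ∈ avoiding F ∧ (n : ℝ) ≤ x} := fun h => by
      have := h.1.1; omega
    rw [← Set.ncard_insert_of_notMem h0 (finite_le _ x), hg]
    simp only
    rw [← Set.ncard_coe_finset]
    congr 1
    ext n
    simp only [Set.mem_insert_iff, Set.mem_ofPred_eq, avoiding, Finset.coe_filter, Finset.mem_range]
    rcases Nat.eq_zero_or_pos n with rfl | hn
    · simp [fun l : Lambda k => (one_sub_two_div_pos hk l).le]
    · rw [← Nat.le_floor_iff hx, Nat.lt_succ_iff]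
      have : (∀ l ∈ F, ∀ a : ℕ, ¬ ((n : ℝ) < a * (l : ℝ) ∧ a * (l : ℝ) < n + 2)) ↔
          ∀ i : F, Int.fract (n * (1 / ((i : Lambda k) : ℝ))) ≤ 1 - 2 / ((i : Lambda k) : ℝ) := by
        refine Iff.trans ?_ Subtype.forall.symm
        exact forall₂_congr fun l _ => forall_not_between_iff (two_lt_of_mem_Lambda hk l.2) n
      rw [this]
      constructor
      · rintro (h | ⟨⟨_, h1⟩, h2⟩)
        · omega
        · exact ⟨h2, h1⟩
      · rintro ⟨h1, h2⟩
        exact Or.inr ⟨⟨hn, h2⟩, h1⟩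
  have h1 : Tendsto (fun x : ℝ => (((⌊x⌋₊ : ℕ) : ℝ) + 1) / x) atTop (𝓝 1) := by
    have := (tendsto_nat_floor_div_atTop (R := ℝ)).add tendsto_inv_atTop_zero
    rw [add_zero] at this
    refine this.congr fun x => ?_
    rw [add_div, one_div]
  have h2 := ((hw.comp tendsto_nat_floor_atTop).mul h1).sub tendsto_inv_atTop_zero
  rw [mul_one, sub_zero] at h2
  refine h2.congr' ?_
  filter_upwards [eventually_gt_atTop (0 : ℝ)] with x hx
  have h3 : (({n : ℕ | n ∈ avoiding F ∧ (n : ℝ) ≤ x}.ncard : ℕ) : ℝ) = (g ⌊x⌋₊ : ℝ) - 1 := by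
    rw [← hcount x hx.le]; push_cast; ring
  rw [h3]
  simp only [Function.comp]
  have h4 : ((⌊x⌋₊ : ℕ) : ℝ) + 1 ≠ 0 := by positivity
  change (g ⌊x⌋₊ : ℝ) / _ * _ - _ = _
  field_simp

/-- The number of `n ≤ x` such that `(n, n + 2)` contains a multiple of `l`. -/
lemma ncard_between_le {l : ℝ} (hl : 0 < l) {x : ℝ} (hx : 0 ≤ x) :
    (({n : ℕ | (∃ a : ℕ, (n : ℝ) < a * l ∧ a * l < n + 2) ∧ (n : ℝ) ≤ x}.ncard : ℕ) : ℝ) ≤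
      2 * (x + 2) * (1 / l) := by
  set A := {n : ℕ | (∃ a : ℕ, (n : ℝ) < a * l ∧ a * l < n + 2) ∧ (n : ℝ) ≤ x}
  set M := ⌊(x + 2) / l⌋₊
  -- If `n < a * l < n + 2`, then `n` is `⌈a * l⌉ - 1` or `⌈a * l⌉ - 2`. Since `1 ≤ a ≤ (x + 2) /
  -- l`, no additive constant appears and there are no such `n` once `l > x + 2`.
  let T : Finset ℕ := (Finset.Icc 1 M ×ˢ Finset.range 2).image
    fun q => ⌈(q.1 : ℝ) * l⌉₊ - 1 - q.2
  have hsub : A ⊆ T := by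
    rintro n ⟨⟨a, h1, h2⟩, h3⟩
    have hn : (0 : ℝ) ≤ n := by positivity
    simp only [T, Finset.coe_image, Set.mem_image, Finset.mem_coe, Finset.mem_product,
      Finset.mem_Icc, Finset.mem_range, Prod.exists]
    have ha : 1 ≤ a := by
      rcases Nat.eq_zero_or_pos a with rfl | ha
      · simp at h1; linarith
      · exact ha
    have haM : a ≤ M := Nat.le_floor (by rw [le_div_iff₀ hl]; linarith)
    have h4 : n < ⌈(a : ℝ) * l⌉₊ := Nat.lt_ceil.2 h1
    have h5 : ⌈(a : ℝ) * l⌉₊ ≤ n + 2 := Nat.ceil_le.2 (by push_cast; exact h2.le)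
    exact ⟨a, ⌈(a : ℝ) * l⌉₊ - 1 - n, ⟨⟨ha, haM⟩, by omega⟩, by omega⟩
  have hcard : A.ncard ≤ M * 2 := by
    calc A.ncard ≤ (T : Set ℕ).ncard := Set.ncard_le_ncard hsub T.finite_toSet
      _ = T.card := Set.ncard_coe_finset T
      _ ≤ _ := Finset.card_image_le
      _ = M * 2 := by simp
  have hM : (M : ℝ) ≤ (x + 2) / l := Nat.floor_le (by positivity)
  calc (A.ncard : ℝ) ≤ M * 2 := by exact_mod_cast hcard
    _ ≤ (x + 2) / l * 2 := by gcongr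
    _ = _ := by ring

lemma B_subset_avoiding {k : ℕ} (hk : 2 ≤ k) (F : Finset (Lambda k)) : B k ⊆ avoiding F :=
  fun n hn => by
    have h := (mem_B_iff hk n).1 hn
    exact ⟨h.1, fun l _ => h.2 l l.2⟩

/-- If the reciprocal sums over finite sets disjoint from `F` are at most `ε`, then few elements of
`avoiding F` are missing from `B k`. -/
lemma ncard_avoiding_le {k : ℕ} (hk : 2 ≤ k) (F : Finset (Lambda k)) {ε : ℝ}
    (hF : ∀ G : Finset (Lambda k), Disjoint G F → ∑ l ∈ G, 1 / (l : ℝ) ≤ ε) {x : ℝ} (hx : 0 ≤ x) :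
    (({n : ℕ | n ∈ avoiding F ∧ (n : ℝ) ≤ x}.ncard : ℕ) : ℝ) ≤
      ({n : ℕ | n ∈ B k ∧ (n : ℝ) ≤ x}.ncard : ℕ) + 2 * (x + 2) * ε := by
  classical
  set D : Set ℕ := {n : ℕ | n ∈ avoiding F ∧ (n : ℝ) ≤ x} \ {n : ℕ | n ∈ B k ∧ (n : ℝ) ≤ x}
  have hDfin : D.Finite := (finite_le _ x).subset Set.sdiff_subset
  have hex : ∀ n ∈ D, ∃ l : Lambda k, l ∉ F ∧
      ∃ a : ℕ, (n : ℝ) < a * (l : ℝ) ∧ a * (l : ℝ) < n + 2 := by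
    rintro n ⟨⟨⟨h1, h2⟩, h3⟩, h4⟩
    have h5 : n ∉ B k := fun h => h4 ⟨h, h3⟩
    rw [mem_B_iff hk] at h5
    push Not at h5
    obtain ⟨l, hl, a, ha⟩ := h5 h1
    refine ⟨⟨l, hl⟩, fun hlF => h2 _ hlF a ha, a, ha⟩
  choose L hLF hL using hex
  -- For fixed `x` only finitely many `n` are missing, so one culprit `l` for each gives a finite
  -- set to which the tail bound applies.
  let G : Finset (Lambda k) := hDfin.toFinset.attach.image
    fun n : {m // m ∈ hDfin.toFinset} => L n.1 (hDfin.mem_toFinset.1 n.2)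
  have hGF : Disjoint G F := by
    rw [Finset.disjoint_left]
    intro l hl
    obtain ⟨n, hn, rfl⟩ := Finset.mem_image.1 hl
    exact hLF n _
  have hDcard : (D.ncard : ℝ) ≤ 2 * (x + 2) * ε := by
    let A : Lambda k → Set ℕ := fun l =>
      {n : ℕ | (∃ a : ℕ, (n : ℝ) < a * (l : ℝ) ∧ a * (l : ℝ) < n + 2) ∧ (n : ℝ) ≤ x}
    have hsub : D ⊆ ⋃ l ∈ G, A l := by
      intro n hn
      simp only [Set.mem_iUnion]
      exact ⟨L n hn, Finset.mem_image.2 ⟨⟨n, hDfin.mem_toFinset.2 hn⟩, Finset.mem_attach _ _, rfl⟩,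
        hL n hn, hn.1.2⟩
    have hAfin : ∀ l, (A l).Finite := fun l =>
      (Set.finite_Iic ⌊x⌋₊).subset fun _ hn => Nat.le_floor hn.2
    have h1 : D.ncard ≤ ∑ l ∈ G, (A l).ncard :=
      (Set.ncard_le_ncard hsub (G.finite_toSet.biUnion fun l _ => hAfin l)).trans
        (Finset.set_ncard_biUnion_le G A)
    calc (D.ncard : ℝ) ≤ ∑ l ∈ G, ((A l).ncard : ℝ) := by exact_mod_cast h1
      _ ≤ ∑ l ∈ G, 2 * (x + 2) * (1 / (l : ℝ)) :=
        Finset.sum_le_sum fun l _ => ncard_between_le (Lambda_pos l.2) hx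
      _ = 2 * (x + 2) * ∑ l ∈ G, 1 / (l : ℝ) := by rw [Finset.mul_sum]
      _ ≤ _ := by gcongr; exact hF G hGF
  have h2 := Set.ncard_le_ncard_sdiff_add_ncard {n : ℕ | n ∈ avoiding F ∧ (n : ℝ) ≤ x}
    {n : ℕ | n ∈ B k ∧ (n : ℝ) ≤ x} (finite_le _ x)
  have h3 : (({n : ℕ | n ∈ avoiding F ∧ (n : ℝ) ≤ x}.ncard : ℕ) : ℝ) ≤
      D.ncard + ({n : ℕ | n ∈ B k ∧ (n : ℝ) ≤ x}.ncard : ℕ) := by exact_mod_cast h2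
  linarith

theorem hasDensity_B {k : ℕ} (hk : 2 ≤ k) : HasDensity (B k) (C k) := by
  classical
  rw [HasDensity, Metric.tendsto_atTop]
  intro ε hε
  -- For `x ≥ 2` one has `2 * (x + 2) * (ε / 16) ≤ x * (ε / 4)`.
  obtain ⟨F₁, hF₁⟩ := summable_iff_vanishing_norm.1 (summable_one_div_Lambda hk) (ε / 16)
    (by positivity)
  obtain ⟨F₂, hF₂⟩ := (Metric.tendsto_atTop.1 (multipliable_one_sub hk).hasProd) (ε / 4)
    (by positivity)
  set F := F₁ ∪ F₂
  have hF : ∀ G : Finset (Lambda k), Disjoint G F → ∑ l ∈ G, 1 / (l : ℝ) ≤ ε / 16 := fun G hG =>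
    (Real.le_norm_self _).trans
      (hF₁ G (hG.mono_right Finset.subset_union_left)).le
  have hprod : dist (∏ l ∈ F, (1 - 2 / (l : ℝ))) (C k) < ε / 4 := hF₂ F Finset.subset_union_right
  obtain ⟨x₀, hx₀⟩ := Metric.tendsto_atTop.1 (hasDensity_avoiding hk F) (ε / 4) (by positivity)
  refine ⟨max x₀ 2, fun x hx => ?_⟩
  have hx2 : 2 ≤ x := (le_max_right _ _).trans hx
  have hx0 : 0 < x := by linarith
  have hdens := hx₀ x ((le_max_left _ _).trans hx)
  have hup := ncard_avoiding_le hk F hF hx0.le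
  have hlow : (({n : ℕ | n ∈ B k ∧ (n : ℝ) ≤ x}.ncard : ℕ) : ℝ) ≤
      ({n : ℕ | n ∈ avoiding F ∧ (n : ℝ) ≤ x}.ncard : ℕ) := by
    have hsub : {n : ℕ | n ∈ B k ∧ (n : ℝ) ≤ x} ⊆ {n : ℕ | n ∈ avoiding F ∧ (n : ℝ) ≤ x} :=
      fun n hn => ⟨B_subset_avoiding hk F hn.1, hn.2⟩
    exact_mod_cast Set.ncard_le_ncard hsub (finite_le _ x)
  set β : ℝ := (({n : ℕ | n ∈ B k ∧ (n : ℝ) ≤ x}.ncard : ℕ) : ℝ)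
  set γ : ℝ := (({n : ℕ | n ∈ avoiding F ∧ (n : ℝ) ≤ x}.ncard : ℕ) : ℝ)
  have h1 : β / x ≤ γ / x := by gcongr
  have h2 : γ / x ≤ β / x + ε / 4 := by
    rw [div_le_iff₀ hx0, add_mul, div_mul_cancel₀ _ hx0.ne']
    nlinarith
  rw [Real.dist_eq, abs_lt] at *
  constructor <;> linarith [hdens.1, hdens.2, hprod.1, hprod.2]

/-- A finite set has density zero, whereas `C k > 0`. -/
lemma B_infinite {k : ℕ} (hk : 2 ≤ k) : (B k).Infinite := by
  intro hfin
  have h0 : Tendsto (fun x : ℝ => (({n : ℕ | n ∈ B k ∧ (n : ℝ) ≤ x}.ncard : ℕ) : ℝ) / x) atTop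
      (𝓝 0) := by
    have h1 : Tendsto (fun x : ℝ => ((B k).ncard : ℝ) / x) atTop (𝓝 0) :=
      tendsto_const_nhds.div_atTop tendsto_id
    refine tendsto_of_tendsto_of_tendsto_of_le_of_le' tendsto_const_nhds h1 ?_ ?_
    · filter_upwards [eventually_ge_atTop (0 : ℝ)] with x hx
      positivity
    · filter_upwards [eventually_ge_atTop (0 : ℝ)] with x hx
      gcongr
      exact fun n hn => hn.1
  exact (C_pos hk).ne (tendsto_nhds_unique h0 (hasDensity_B hk))

/-- For `n ∈ B k`, the only `k`-full integer in `(n ^ k, (n + 2) ^ k)` is `(n + 1) ^ k`. -/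
lemma eq_succ_pow_of_mem_B {k n m : ℕ} (hn : n ∈ B k) (h1 : n ^ k < m)
    (h2 : m < (n + 2) ^ k) (hm : IsFull k m) : m = (n + 1) ^ k := by
  have h : m ∉ S k := fun hS => (Set.eq_empty_iff_forall_notMem.1 hn.2) m ⟨⟨h1, h2⟩, hS⟩
  have h3 : ∃ a : ℕ, m = a ^ k := by
    by_contra hcon
    exact h ⟨hm, hcon⟩
  obtain ⟨a, rfl⟩ := h3
  have h4 : n < a := lt_of_pow_lt_pow_left' k h1
  have h5 : a < n + 2 := lt_of_pow_lt_pow_left' k h2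
  rw [show a = n + 1 by omega]

end Density

/-! ### Series for `ζ(3/2)` and `ζ(3)`: the squarefree identity and tail bounds. -/

section Numerics

/-- The number `n ^ (-3/2)`. -/
noncomputable def w (n : ℕ) : ℝ := 1 / √((n : ℝ) ^ 3)

lemma w_nonneg (n : ℕ) : 0 ≤ w n := by unfold w; positivity

lemma w_sq (n : ℕ) : w n ^ 2 = 1 / (n : ℝ) ^ 3 := by
  rw [w, div_pow, one_pow, Real.sq_sqrt (by positivity)]

lemma w_eq_rpow (n : ℕ) : w n = 1 / (n : ℝ) ^ (3 / 2 : ℝ) := by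
  rw [w, Real.sqrt_eq_rpow, ← Real.rpow_natCast, ← Real.rpow_mul (by positivity)]
  norm_num

lemma summable_w : Summable w := by
  simp_rw [funext w_eq_rpow]
  exact Real.summable_one_div_nat_rpow.2 (by norm_num)

lemma summable_inv_cube : Summable fun n : ℕ => 1 / (n : ℝ) ^ 3 :=
  Real.summable_one_div_nat_pow.2 (by norm_num)

lemma w_sq_mul (a b : ℕ) : w (a ^ 2 * b) = w b * (1 / (a : ℝ) ^ 3) := by
  have : (((a ^ 2 * b : ℕ) : ℝ)) ^ 3 = ((a : ℝ) ^ 3) ^ 2 * (b : ℝ) ^ 3 := by push_cast; ring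
  rw [w, w, this, Real.sqrt_mul (by positivity), Real.sqrt_sq (by positivity), ← one_div_mul_one_div,
    mul_comm]

/-! ### Squarefree sums -/

/-- The squarefree part is unique. -/
lemma sq_mul_squarefree_injective :
    Function.Injective fun q : {b : ℕ // Squarefree b} × {a : ℕ // a ≠ 0} =>
      (q.2 : ℕ) ^ 2 * (q.1 : ℕ) := by
  rintro ⟨⟨b, hb⟩, ⟨a, ha⟩⟩ ⟨⟨b', hb'⟩, ⟨a', ha'⟩⟩ h
  simp only at h
  have hbb : b = b' := by
    apply Nat.eq_of_factorization_eq hb.ne_zero hb'.ne_zero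
    intro p
    have h1 := congrArg (fun m => m.factorization p) h
    simp only [Nat.factorization_mul (pow_ne_zero 2 ha) hb.ne_zero,
      Nat.factorization_mul (pow_ne_zero 2 ha') hb'.ne_zero, Nat.factorization_pow,
      Finsupp.add_apply, Finsupp.smul_apply, smul_eq_mul] at h1
    have h2 := hb.natFactorization_le_one p
    have h3 := hb'.natFactorization_le_one p
    omega
  subst hbb
  have haa : a = a' := by
    have := Nat.eq_of_mul_eq_mul_right (Nat.pos_of_ne_zero hb.ne_zero) h
    exact Nat.pow_left_injective (n := 2) (by norm_num) this
  subst haa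
  rfl

/-- Every `n ≥ 1` is uniquely `a ^ 2 * b` with `b` squarefree, and `w` then splits as `w b / a ^ 3`:
the squarefree sum is `ζ(3/2) / ζ(3)`. -/
lemma tsum_squarefree_mul_tsum_inv_cube :
    (∑' b : {b : ℕ // Squarefree b}, w b) * (∑' n : ℕ, 1 / (n : ℝ) ^ 3) = ∑' n, w n := by
  have h1 : ∑' a : {a : ℕ // a ≠ 0}, 1 / ((a : ℕ) : ℝ) ^ 3 = ∑' n : ℕ, 1 / (n : ℝ) ^ 3 :=
    tsum_subtype_eq_of_support_subset (f := fun n : ℕ => 1 / (n : ℝ) ^ 3) (s := {a | a ≠ 0}) (by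
      intro n hn h0
      simp [h0] at hn)
  have h2 : Summable fun b : {b : ℕ // Squarefree b} => w b :=
    summable_w.comp_injective Subtype.val_injective
  have h3 : Summable fun a : {a : ℕ // a ≠ 0} => 1 / ((a : ℕ) : ℝ) ^ 3 :=
    summable_inv_cube.comp_injective Subtype.val_injective
  rw [← h1, tsum_mul_tsum_of_summable_norm h2.norm h3.norm, ← sq_mul_squarefree_injective.tsum_eq]
  · exact tsum_congr fun q => (w_sq_mul _ _).symm
  · intro n hn
    -- Division by zero makes `w 0 = 0`, so the index `0` is harmless.
    have hn0 : n ≠ 0 := by rintro rfl; simp [w] at hn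
    obtain ⟨b, a, -, ha, hab, hb⟩ := Nat.sq_mul_squarefree_of_pos (Nat.pos_of_ne_zero hn0)
    exact ⟨⟨⟨b, hb⟩, ⟨a, ha.ne'⟩⟩, by simpa [mul_comm] using hab⟩

/-! ### Tails of series by telescoping -/

lemma tsum_tail_le {f g : ℕ → ℝ} (hf : ∀ n, 0 ≤ f n) (hg : ∀ n, 0 ≤ g n) {N : ℕ}
    (h : ∀ n, N ≤ n → f n ≤ g n - g (n + 1)) : ∑' n, f (n + N) ≤ g N := by
  refine Real.tsum_le_of_sum_range_le (fun n => hf _) fun m => ?_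
  have : ∑ i ∈ Finset.range m, f (i + N) ≤ ∑ i ∈ Finset.range m, (g (i + N) - g (i + 1 + N)) :=
    Finset.sum_le_sum fun i _ => by
      have := h (i + N) (by omega)
      rwa [show i + 1 + N = i + N + 1 by ring]
  rw [Finset.sum_range_sub' (fun i => g (i + N))] at this
  have h2 := hg (m + N)
  simp only [zero_add] at this
  linarith

lemma le_tsum_tail {f g : ℕ → ℝ} (hf : Summable f) (hg : Tendsto g atTop (𝓝 0)) {N : ℕ}
    (h : ∀ n, N ≤ n → g n - g (n + 1) ≤ f n) : g N ≤ ∑' n, f (n + N) := by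
  have h1 := ((summable_nat_add_iff N).2 hf).hasSum.tendsto_sum_nat
  have h2 : Tendsto (fun m => g N - g (m + N)) atTop (𝓝 (g N - 0)) :=
    tendsto_const_nhds.sub (hg.comp (tendsto_add_atTop_nat N))
  rw [sub_zero] at h2
  refine le_of_tendsto_of_tendsto' h2 h1 fun m => ?_
  have : ∑ i ∈ Finset.range m, (g (i + N) - g (i + 1 + N)) ≤ ∑ i ∈ Finset.range m, f (i + N) :=
    Finset.sum_le_sum fun i _ => by
      have := h (i + N) (by omega)
      rwa [show i + 1 + N = i + N + 1 by ring]
  rw [Finset.sum_range_sub' (fun i => g (i + N))] at this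
  simpa using this

lemma two_div_sqrt_sub {x : ℝ} (hx : 0 < x) :
    2 / √x - 2 / √(x + 1) = 2 / (√x * √(x + 1) * (√x + √(x + 1))) := by
  have h1 : 0 < √x := Real.sqrt_pos.2 hx
  have h2 : 0 < √(x + 1) := Real.sqrt_pos.2 (by linarith)
  have h3 : √x ^ 2 = x := Real.sq_sqrt hx.le
  have h4 : √(x + 1) ^ 2 = x + 1 := Real.sq_sqrt (by linarith)
  field_simp
  nlinarith

lemma w_eq_sqrt (n : ℕ) : w n = 1 / ((n : ℝ) * √n) := by
  rw [w, show (n : ℝ) ^ 3 = (n : ℝ) ^ 2 * n by ring, Real.sqrt_mul (by positivity),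
    Real.sqrt_sq (by positivity)]

/-- The midpoint bound for `n ^ (-3/2)`. -/
lemma w_le {n : ℕ} (hn : 1 ≤ n) : w n ≤ 2 / √((n : ℝ) - 1 / 2) - 2 / √((n : ℝ) - 1 / 2 + 1) := by
  have hn' : (1 : ℝ) ≤ n := by exact_mod_cast hn
  rw [two_div_sqrt_sub (by linarith), w_eq_sqrt]
  set x := (n : ℝ) - 1 / 2 with hx
  have hx0 : 0 < x := by linarith
  have hnx : (n : ℝ) = x + 1 / 2 := by linarith
  have ha : 0 < √x := Real.sqrt_pos.2 hx0
  have hb : 0 < √(x + 1) := Real.sqrt_pos.2 (by linarith)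
  have ha2 : √x ^ 2 = x := Real.sq_sqrt hx0.le
  have hb2 : √(x + 1) ^ 2 = x + 1 := Real.sq_sqrt (by linarith)
  have h1 : √x * √(x + 1) ≤ n := by nlinarith [sq_nonneg (√x - √(x + 1))]
  have h2 : √x + √(x + 1) ≤ 2 * √n := by
    refine (pow_le_pow_iff_left₀ (by positivity) (by positivity) two_ne_zero).1 ?_
    rw [mul_pow, Real.sq_sqrt (by positivity)]
    nlinarith [sq_nonneg (√x - √(x + 1))]
  rw [div_le_div_iff₀ (by positivity) (by positivity)]
  have h3 : √x * √(x + 1) * (√x + √(x + 1)) ≤ n * (2 * √n) :=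
    mul_le_mul h1 h2 (by positivity) (by positivity)
  linarith

/-- A shifted midpoint bound for `n ^ (-3/2)`. -/
lemma le_w {n : ℕ} (hn : 1000 ≤ n) {δ : ℝ} (hδ : δ = 1 / 8000) :
    2 / √((n : ℝ) - 1 / 2 + δ) - 2 / √((n : ℝ) - 1 / 2 + δ + 1) ≤ w n := by
  have hn' : (1000 : ℝ) ≤ n := by exact_mod_cast hn
  rw [two_div_sqrt_sub (by rw [hδ]; linarith), w_eq_sqrt]
  set x := (n : ℝ) - 1 / 2 + δ with hx
  have hx0 : 0 < x := by rw [hx, hδ]; linarith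
  have ha : 0 < √x := Real.sqrt_pos.2 hx0
  have hb : 0 < √(x + 1) := Real.sqrt_pos.2 (by linarith)
  -- Here `x * (x + 1) = (n + δ) ^ 2 - 1 / 4`, which is at least `n ^ 2` because `2 * n * δ ≥ 1 / 4`
  -- for `n ≥ 1000` and `δ = 1 / 8000`.
  have h1 : (n : ℝ) ≤ √x * √(x + 1) := by
    rw [← Real.sqrt_mul hx0.le]
    apply Real.le_sqrt_of_sq_le
    rw [hx, hδ]
    nlinarith
  have h2 : 2 * √n ≤ √x + √(x + 1) := by
    have h3 : √(n : ℝ) ≤ √(√x * √(x + 1)) := Real.sqrt_le_sqrt h1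
    have h4 := Real.sqrt_nonneg (√x * √(x + 1))
    have h5 : √(√x * √(x + 1)) ^ 2 = √x * √(x + 1) := Real.sq_sqrt (by positivity)
    have h6 : 2 * √(√x * √(x + 1)) ≤ √x + √(x + 1) := by
      refine (pow_le_pow_iff_left₀ (by positivity) (by positivity) two_ne_zero).1 ?_
      nlinarith [sq_nonneg (√x - √(x + 1))]
    linarith
  have hn0 : (0 : ℝ) < n := by linarith
  have hs : 0 < √(n : ℝ) := Real.sqrt_pos.2 hn0
  rw [div_le_div_iff₀ (by positivity) (by positivity)]
  have h3 : n * (2 * √n) ≤ √x * √(x + 1) * (√x + √(x + 1)) :=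
    mul_le_mul h1 h2 (by positivity) (by positivity)
  linarith

lemma tsum_w_tail_le : ∑' n, w (n + 1001) ≤ 2 / √1000.5 := by
  have := tsum_tail_le (f := w) (g := fun n : ℕ => 2 / √((n : ℝ) - 1 / 2)) w_nonneg
    (fun n => by positivity) (N := 1001) (fun n hn => by
      have := w_le (n := n) (by omega)
      push_cast
      rwa [show (n : ℝ) + 1 - 1 / 2 = n - 1 / 2 + 1 by ring])
  refine this.trans (le_of_eq ?_)
  norm_num

lemma le_tsum_w_tail : 2 / √(1000.5 + 1 / 8000) ≤ ∑' n, w (n + 1001) := by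
  have := le_tsum_tail (f := w) (g := fun n : ℕ => 2 / √((n : ℝ) - 1 / 2 + 1 / 8000)) summable_w
    (by
      refine tendsto_const_nhds.div_atTop (Real.tendsto_sqrt_atTop.comp ?_)
      simp_rw [sub_add]
      exact tendsto_atTop_add_const_right _ _ tendsto_natCast_atTop_atTop)
    (N := 1001) (fun n hn => by
      have := le_w (n := n) (by omega) rfl
      push_cast
      rwa [show (n : ℝ) + 1 - 1 / 2 + 1 / 8000 = n - 1 / 2 + 1 / 8000 + 1 by ring])
  refine (le_of_eq ?_).trans this
  norm_num

lemma tsum_inv_cube_tail_le :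
    ∑' n : ℕ, 1 / ((n + 1001 : ℕ) : ℝ) ^ 3 ≤ 1 / (2 * 1000 * 1001) := by
  have := tsum_tail_le (f := fun n : ℕ => 1 / (n : ℝ) ^ 3)
    (g := fun n : ℕ => 1 / (2 * ((n : ℝ) - 1) * n)) (fun n => by positivity)
    (fun n => by
      rcases Nat.eq_zero_or_pos n with rfl | hn
      · simp
      · have : (1 : ℝ) ≤ n := by exact_mod_cast hn
        have : 0 ≤ (n : ℝ) - 1 := by linarith
        positivity)
    (N := 1001) (fun n hn => by
      have hn' : (1001 : ℝ) ≤ n := by exact_mod_cast hn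
      have hn1 : 0 < (n : ℝ) - 1 := by linarith
      have hn0 : 0 < (n : ℝ) := by linarith
      -- The telescoping difference is `1 / (n ^ 3 - n)`, slightly more than `1 / n ^ 3`.
      have : 1 / (2 * ((n : ℝ) - 1) * n) - 1 / (2 * (((n + 1 : ℕ) : ℝ) - 1) * (n + 1 : ℕ)) =
          1 / ((n - 1) * n * (n + 1)) := by
        push_cast
        rw [add_sub_cancel_right]
        field_simp
        ring
      rw [this]
      exact one_div_le_one_div_of_le (by positivity) (by nlinarith))
  refine this.trans (le_of_eq ?_)
  norm_num

lemma le_tsum_inv_cube_tail :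
    1 / (2 * 1001 ^ 2) ≤ ∑' n : ℕ, 1 / ((n + 1001 : ℕ) : ℝ) ^ 3 := by
  have := le_tsum_tail (f := fun n : ℕ => 1 / (n : ℝ) ^ 3)
    (g := fun n : ℕ => 1 / (2 * (n : ℝ) ^ 2)) summable_inv_cube
    (by
      have h := (tendsto_inv_atTop_nhds_zero_nat (𝕜 := ℝ)).pow 2
      have h2 := h.const_mul (1 / 2)
      simp only [ne_eq, OfNat.ofNat_ne_zero, not_false_eq_true, zero_pow, mul_zero] at h2
      refine h2.congr fun n => ?_
      rw [inv_pow, ← one_div, one_div_mul_one_div])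
    (N := 1001) (fun n hn => by
      have hm : (1 : ℝ) ≤ n := by exact_mod_cast (by omega : 1 ≤ n)
      push_cast
      have hm0 : (0 : ℝ) < n := by linarith
      rw [div_sub_div _ _ (by positivity) (by positivity), div_le_div_iff₀ (by positivity)
        (by positivity)]
      have : (0 : ℝ) ≤ n ^ 2 := by positivity
      nlinarith)
  refine (le_of_eq ?_).trans this
  norm_num

end Numerics

/-! ### Certified integer arithmetic at scale `10 ^ 12`. -/

section FixedPoint

/-- The denominator of the fixed-point approximations. -/
def scale : ℕ := 10 ^ 12

/-- Newton iteration for the integer square root of `x`. -/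
def newton (x : ℕ) : ℕ → ℕ → ℕ
  | 0, s => s
  | n + 1, s => newton x n ((s + x / s) / 2)

/-- A candidate for the integer part of `scale * w b`. -/
def rootApprox (b : ℕ) : ℕ := newton (scale ^ 2 / b ^ 3) 14 (scale / b)

/-- A lower bound for `scale * w b`. -/
def wLo (b : ℕ) : ℕ :=
  cond ((rootApprox b ^ 2).ble (scale ^ 2 / b ^ 3)) (rootApprox b) 0

/-- An upper bound for `scale * w b`. -/
def wHi (b : ℕ) : ℕ :=
  cond ((scale ^ 2 / b ^ 3 + 1).ble ((rootApprox b + 1) ^ 2)) (rootApprox b + 1) scale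

/-- No square `d ^ 2` with `2 ≤ d < m + 2` divides `b`. -/
def noSquareDvd (b : ℕ) : ℕ → Bool
  | 0 => true
  | d + 1 => !((b % (d + 2) ^ 2).beq 0) && noSquareDvd b d

/-- A test for squarefreeness of positive integers below `1024`. -/
def sqf (b : ℕ) : Bool := noSquareDvd b 30

/-- The sum `f 1 + ⋯ + f n`. -/
def sumUpTo (f : ℕ → ℕ) : ℕ → ℕ
  | 0 => 0
  | n + 1 => sumUpTo f n + f (n + 1)

/-- A lower bound for `scale` times the product of `1 - 2 * w b` over squarefree
`2 ≤ b ≤ n + 1`. -/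
def prodLo : ℕ → ℕ
  | 0 => scale
  | n + 1 => cond (sqf (n + 2)) (prodLo n * (scale - 2 * wHi (n + 2)) / scale) (prodLo n)

/-- An upper bound for `scale` times the product of `1 - 2 * w b` over squarefree
`2 ≤ b ≤ n + 1`. -/
def prodHi : ℕ → ℕ
  | 0 => scale
  | n + 1 => cond (sqf (n + 2)) (prodHi n * (scale - 2 * wLo (n + 2)) / scale + 1) (prodHi n)

lemma cast_scale : (scale : ℝ) = 10 ^ 12 := by norm_num [scale]

lemma scale_pos : (0 : ℝ) < scale := by rw [cast_scale]; positivity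

lemma sqrt_cube_pos {b : ℕ} (hb : 1 ≤ b) : 0 < √((b : ℝ) ^ 3) := by
  have : (0 : ℝ) < b := by exact_mod_cast hb
  exact Real.sqrt_pos.2 (by positivity)

/-- Nothing is proved about Newton's iteration. Its output is tested by squaring, and a failed test
falls back to the trivial bound `0` (for `wHi`, to `scale`), so only the quality of the bound is at
stake. -/
lemma wLo_le {b : ℕ} (hb : 1 ≤ b) : (wLo b : ℝ) ≤ scale * w b := by
  have hs := sqrt_cube_pos hb
  unfold wLo
  cases h : (rootApprox b ^ 2).ble (scale ^ 2 / b ^ 3) with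
  | false => simp only [cond_false, Nat.cast_zero]; exact mul_nonneg scale_pos.le (w_nonneg b)
  | true =>
    rw [cond_true]
    have h1 := (Nat.le_div_iff_mul_le (by positivity)).1 (Nat.le_of_ble_eq_true h)
    have h2 : (rootApprox b : ℝ) ^ 2 * (b : ℝ) ^ 3 ≤ (scale : ℝ) ^ 2 := by exact_mod_cast h1
    rw [w, mul_one_div, le_div_iff₀ hs]
    refine (pow_le_pow_iff_left₀ (by positivity) scale_pos.le two_ne_zero).1 ?_
    rwa [mul_pow, Real.sq_sqrt (by positivity)]

lemma w_le_one {b : ℕ} (hb : 1 ≤ b) : w b ≤ 1 := by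
  have : (1 : ℝ) ≤ b := by exact_mod_cast hb
  rw [w, div_le_one (sqrt_cube_pos hb), Real.one_le_sqrt]
  exact one_le_pow₀ this

lemma le_wHi {b : ℕ} (hb : 1 ≤ b) : scale * w b ≤ (wHi b : ℝ) := by
  have hs := sqrt_cube_pos hb
  unfold wHi
  cases h : (scale ^ 2 / b ^ 3 + 1).ble ((rootApprox b + 1) ^ 2) with
  | false =>
    rw [cond_false]
    exact mul_le_of_le_one_right scale_pos.le (w_le_one hb)
  | true =>
    rw [cond_true]
    have h1 := (Nat.div_lt_iff_lt_mul (by positivity)).1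
      (Nat.lt_of_succ_le (Nat.le_of_ble_eq_true h))
    have h2 : (scale : ℝ) ^ 2 ≤ ((rootApprox b + 1 : ℕ) : ℝ) ^ 2 * (b : ℝ) ^ 3 := by
      exact_mod_cast h1.le
    rw [w, mul_one_div, div_le_iff₀ hs]
    refine (pow_le_pow_iff_left₀ scale_pos.le (by positivity) two_ne_zero).1 ?_
    rwa [mul_pow, Real.sq_sqrt (by positivity)]

lemma noSquareDvd_iff (b m : ℕ) : noSquareDvd b m = true ↔ ∀ d < m, ¬ (d + 2) ^ 2 ∣ b := by
  induction m with
  | zero => simp [noSquareDvd]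
  | succ m ih =>
    rw [noSquareDvd, Bool.and_eq_true, ih, Nat.forall_lt_succ_right, and_comm, Nat.dvd_iff_mod_eq_zero]
    refine and_congr_right fun _ => ?_
    rw [Bool.not_eq_true', ← Bool.not_eq_true, Nat.beq_eq]

/-- The trial divisors run from `2` to `31`, which suffices below `32 ^ 2 = 1024`. -/
lemma sqf_iff {b : ℕ} (hb : 1 ≤ b) (hb2 : b < 1024) : sqf b = true ↔ Squarefree b := by
  rw [sqf, noSquareDvd_iff]
  constructor
  · intro h
    rw [Nat.squarefree_iff_prime_squarefree]
    intro p hp hdvd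
    have h1 : p < 32 := by
      by_contra hcon
      have h2 : 32 * 32 ≤ p * p := Nat.mul_le_mul (by omega) (by omega)
      have := Nat.le_of_dvd hb hdvd
      omega
    have h2 := hp.two_le
    refine h (p - 2) (by omega) ?_
    rwa [show p - 2 + 2 = p by omega, pow_two]
  · intro h d _ hdvd
    have := Nat.isUnit_iff.1 (h (d + 2) (by rwa [← pow_two]))
    omega

lemma sumUpTo_eq (f : ℕ → ℕ) (n : ℕ) :
    sumUpTo f n = ∑ i ∈ Finset.range n, f (i + 1) := by
  induction n with
  | zero => rfl
  | succ n ih => rw [sumUpTo, ih, Finset.sum_range_succ]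

lemma sumUpTo_le {f : ℕ → ℕ} {g : ℕ → ℝ} {n : ℕ} (hg : 0 ≤ g 0)
    (h : ∀ b, 1 ≤ b → b ≤ n → (f b : ℝ) ≤ scale * g b) :
    (sumUpTo f n : ℝ) ≤ scale * ∑ b ∈ Finset.range (n + 1), g b := by
  rw [sumUpTo_eq, Finset.sum_range_succ', Nat.cast_sum, mul_add, Finset.mul_sum]
  have := Finset.sum_le_sum (s := Finset.range n) (f := fun i => (f (i + 1) : ℝ))
    (g := fun i => scale * g (i + 1)) fun i hi =>
      h (i + 1) (by omega) (by have := Finset.mem_range.1 hi; omega)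
  have h2 := mul_nonneg scale_pos.le hg
  linarith

lemma le_sumUpTo {f : ℕ → ℕ} {g : ℕ → ℝ} {n : ℕ} (hg : g 0 ≤ 0)
    (h : ∀ b, 1 ≤ b → b ≤ n → scale * g b ≤ (f b : ℝ)) :
    scale * ∑ b ∈ Finset.range (n + 1), g b ≤ (sumUpTo f n : ℝ) := by
  rw [sumUpTo_eq, Finset.sum_range_succ', Nat.cast_sum, mul_add, Finset.mul_sum]
  have := Finset.sum_le_sum (s := Finset.range n) (f := fun i => scale * g (i + 1))
    (g := fun i => (f (i + 1) : ℝ)) fun i hi =>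
      h (i + 1) (by omega) (by have := Finset.mem_range.1 hi; omega)
  have h2 := mul_nonpos_of_nonneg_of_nonpos scale_pos.le hg
  linarith

open Classical in
/-- The factor of the Euler-type product at `b`. -/
noncomputable def factor (b : ℕ) : ℝ := if 2 ≤ b ∧ Squarefree b then 1 - 2 * w b else 1

lemma two_mul_w_lt_one {b : ℕ} (hb : 2 ≤ b) : 2 * w b < 1 := by
  have hb' : (2 : ℝ) ≤ b := by exact_mod_cast hb
  have h1 : (8 : ℝ) ≤ (b : ℝ) ^ 3 := by
    calc (8 : ℝ) = 2 ^ 3 := by norm_num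
      _ ≤ (b : ℝ) ^ 3 := by gcongr
  have h2 : 2 < √((b : ℝ) ^ 3) := by
    rw [Real.lt_sqrt (by norm_num)]; linarith
  rw [w, mul_one_div, div_lt_one (by linarith)]
  exact h2

lemma factor_pos (b : ℕ) : 0 < factor b := by
  unfold factor
  split_ifs with h
  · linarith [two_mul_w_lt_one h.1]
  · exact one_pos

lemma prodLo_le {n : ℕ} (hn : n ≤ 1000) :
    (prodLo n : ℝ) ≤ scale * ∏ i ∈ Finset.range n, factor (i + 2) := by
  induction n with
  | zero => simp [prodLo]
  | succ n ih =>
    have ih := ih (by omega)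
    have hsq := sqf_iff (b := n + 2) (by omega) (by omega)
    rw [Finset.prod_range_succ, prodLo]
    cases h : sqf (n + 2) with
    | false =>
      have hf : factor (n + 2) = 1 := by
        unfold factor; rw [if_neg]; rintro ⟨-, h2⟩; rw [hsq.2 h2] at h; cases h
      rw [cond_false, hf, mul_one]; exact ih
    | true =>
      have hf : factor (n + 2) = 1 - 2 * w (n + 2) := by
        unfold factor; rw [if_pos ⟨by omega, hsq.1 h⟩]
      have h1 : ((scale - 2 * wHi (n + 2) : ℕ) : ℝ) ≤ scale * factor (n + 2) := by
        rcases le_total (2 * wHi (n + 2)) scale with hle | hle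
        · rw [Nat.cast_sub hle, hf]
          push_cast
          linarith [le_wHi (b := n + 2) (by omega)]
        · rw [Nat.sub_eq_zero_of_le hle, Nat.cast_zero]
          exact mul_nonneg scale_pos.le (factor_pos _).le
      rw [cond_true]
      refine Nat.cast_div_le.trans ?_
      rw [div_le_iff₀ scale_pos, Nat.cast_mul]
      calc (prodLo n : ℝ) * ((scale - 2 * wHi (n + 2) : ℕ) : ℝ)
          ≤ (scale * ∏ i ∈ Finset.range n, factor (i + 2)) * (scale * factor (n + 2)) :=
            mul_le_mul ih h1 (by positivity) ((Nat.cast_nonneg _).trans ih)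
        _ = _ := by ring

lemma le_prodHi {n : ℕ} (hn : n ≤ 1000) :
    scale * ∏ i ∈ Finset.range n, factor (i + 2) ≤ (prodHi n : ℝ) := by
  induction n with
  | zero => simp [prodHi]
  | succ n ih =>
    have ih := ih (by omega)
    have hsq := sqf_iff (b := n + 2) (by omega) (by omega)
    rw [Finset.prod_range_succ, prodHi]
    cases h : sqf (n + 2) with
    | false =>
      have hf : factor (n + 2) = 1 := by
        unfold factor; rw [if_neg]; rintro ⟨-, h2⟩; rw [hsq.2 h2] at h; cases h
      rw [cond_false, hf, mul_one]; exact ih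
    | true =>
      have hf : factor (n + 2) = 1 - 2 * w (n + 2) := by
        unfold factor; rw [if_pos ⟨by omega, hsq.1 h⟩]
      have h1 : scale * factor (n + 2) ≤ ((scale - 2 * wLo (n + 2) : ℕ) : ℝ) := by
        have : (scale : ℝ) ≤ ((scale - 2 * wLo (n + 2) : ℕ) : ℝ) + 2 * wLo (n + 2) := by
          exact_mod_cast (by omega : scale ≤ scale - 2 * wLo (n + 2) + 2 * wLo (n + 2))
        rw [hf]
        linarith [wLo_le (b := n + 2) (by omega)]
      rw [cond_true]
      have h2 : (prodHi n : ℝ) * ((scale - 2 * wLo (n + 2) : ℕ) : ℝ) / scale ≤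
          ((prodHi n * (scale - 2 * wLo (n + 2)) / scale + 1 : ℕ) : ℝ) := by
        rw [← Nat.cast_mul]
        rw [Nat.cast_add, Nat.cast_one]
        exact (Nat.lt_floor_add_one _).le.trans (by rw [Nat.floor_div_eq_div])
      refine le_trans ?_ h2
      rw [le_div_iff₀ scale_pos]
      calc scale * ((∏ i ∈ Finset.range n, factor (i + 2)) * factor (n + 2)) * scale
          = (scale * ∏ i ∈ Finset.range n, factor (i + 2)) * (scale * factor (n + 2)) := by ring
        _ ≤ _ := mul_le_mul ih h1 (mul_nonneg scale_pos.le (factor_pos _).le) (by positivity)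

end FixedPoint

/-! ### Numerical enclosure of `C 2`. -/

section ConstantTwo

/-- The squarefree integers `b ≥ 2`, which index `Lambda 2`. -/
def squarefreeGeTwo : Set ℕ := {b | 2 ≤ b ∧ Squarefree b}

lemma mem_Lambda_two_iff (x : ℝ) :
    x ∈ Lambda 2 ↔ ∃ b : ℕ, b ∈ squarefreeGeTwo ∧ x = √((b : ℝ) ^ 3) := by
  constructor
  · rintro ⟨b, -, h2, h3, rfl⟩
    have huniv : (Finset.univ : Finset (Fin (2 - 1))) = {(0 : Fin 1)} := rfl
    rw [huniv, Finset.prod_singleton] at h2 h3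
    refine ⟨b (0 : Fin 1), ⟨h2, h3⟩, ?_⟩
    rw [huniv, Finset.prod_singleton, Real.sqrt_eq_rpow]
    rfl
  · rintro ⟨b, ⟨h2, h3⟩, rfl⟩
    have huniv : (Finset.univ : Finset (Fin (2 - 1))) = {(0 : Fin 1)} := rfl
    refine ⟨fun _ => b, fun _ => one_le_two.trans h2, ?_, ?_, ?_⟩
    · rw [huniv, Finset.prod_singleton]; exact h2
    · rw [huniv, Finset.prod_singleton]; exact h3
    · rw [huniv, Finset.prod_singleton, Real.sqrt_eq_rpow]
      rfl

lemma exists_hasSum_log_factor :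
    ∃ L : ℝ, C 2 = Real.exp L ∧ HasSum (fun n => Real.log (factor n)) L := by
  classical
  refine ⟨_, C_eq_exp le_rfl, ?_⟩
  let e : squarefreeGeTwo → Lambda 2 := fun b =>
    ⟨√((b : ℝ) ^ 3), (mem_Lambda_two_iff _).2 ⟨b, b.2, rfl⟩⟩
  have he : Function.Bijective e := by
    constructor
    · intro b b' h
      have h1 : √(((b : ℕ) : ℝ) ^ 3) = √(((b' : ℕ) : ℝ) ^ 3) := congrArg Subtype.val h
      rw [Real.sqrt_inj (by positivity) (by positivity)] at h1
      have h2 : (b : ℕ) ^ 3 = (b' : ℕ) ^ 3 := by exact_mod_cast h1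
      exact Subtype.ext (Nat.pow_left_injective (n := 3) (by norm_num) h2)
    · rintro ⟨x, hx⟩
      obtain ⟨b, hb, rfl⟩ := (mem_Lambda_two_iff x).1 hx
      exact ⟨⟨b, hb⟩, rfl⟩
  have h1 := (Equiv.hasSum_iff (Equiv.ofBijective e he)).2 (summable_log_one_sub le_rfl).hasSum
  have h2 : HasSum ((fun n => Real.log (factor n)) ∘ ((↑) : squarefreeGeTwo → ℕ))
      (∑' l : Lambda 2, Real.log (1 - 2 / (l : ℝ))) := by
    refine h1.congr_fun fun b => ?_
    simp only [Function.comp, factor]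
    rw [if_pos (show 2 ≤ (b : ℕ) ∧ Squarefree (b : ℕ) from b.2), w, mul_one_div]
    rfl
  refine (hasSum_subtype_iff_of_support_subset ?_).1 h2
  intro n hn
  by_contra hcon
  apply hn
  simp only [factor]
  rw [if_neg (show ¬ (2 ≤ n ∧ Squarefree n) from hcon), Real.log_one]

open Classical in
/-- The function `w` restricted to squarefree integers. -/
noncomputable def wSquarefree (n : ℕ) : ℝ := if Squarefree n then w n else 0

lemma wSquarefree_nonneg (n : ℕ) : 0 ≤ wSquarefree n := by
  unfold wSquarefree; split_ifs
  · exact w_nonneg n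
  · exact le_rfl

lemma summable_wSquarefree : Summable wSquarefree :=
  summable_w.of_nonneg_of_le wSquarefree_nonneg fun n => by
    unfold wSquarefree; split_ifs
    · exact le_rfl
    · exact w_nonneg n

lemma tsum_wSquarefree_mul :
    (∑' n, wSquarefree n) * (∑' n : ℕ, 1 / (n : ℝ) ^ 3) = ∑' n, w n := by
  rw [← tsum_squarefree_mul_tsum_inv_cube]
  congr 1
  have := tsum_subtype {b : ℕ | Squarefree b} w
  refine Eq.trans (tsum_congr fun n => ?_) this.symm
  rw [wSquarefree, Set.indicator_apply]
  congr

/-- The terms of the remainder series, for large index. -/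
lemma log_factor_add_bounds {n : ℕ} (hn : 1001 ≤ n) :
    -(4.04 * (1 / (n : ℝ) ^ 3)) ≤ Real.log (factor n) + 2 * wSquarefree n ∧
      Real.log (factor n) + 2 * wSquarefree n ≤ 0 := by
  by_cases hsq : Squarefree n
  · rw [factor, if_pos ⟨by omega, hsq⟩, wSquarefree, if_pos hsq]
    have h0 := w_nonneg n
    have h1 : w n ≤ 1 / 1000 := by
      refine (pow_le_pow_iff_left₀ h0 (by norm_num) two_ne_zero).1 ?_
      have hn' : (100 : ℝ) ≤ n := by exact_mod_cast (by omega : 100 ≤ n)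
      rw [w_sq, div_pow, one_pow]
      refine one_div_le_one_div_of_le (by norm_num) ?_
      calc (1000 : ℝ) ^ 2 = 100 ^ 3 := by norm_num
        _ ≤ (n : ℝ) ^ 3 := by gcongr
    have hpos : 0 < 1 - 2 * w n := by linarith
    constructor
    · have h2 := Real.one_sub_inv_le_log_of_pos hpos
      -- The exact second-order term is `4 * w ^ 2 / (1 - 2 * w)`; the constant `4.04` leaves ample
      -- room for `w ≤ 1 / 1000`.
      have h3 : 1 - (1 - 2 * w n)⁻¹ ≥ -(2 * w n) - 4.04 * w n ^ 2 := by
        rw [ge_iff_le, ← sub_nonneg]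
        have : 1 - (1 - 2 * w n)⁻¹ - (-(2 * w n) - 4.04 * w n ^ 2) =
            w n ^ 2 * (0.04 - 8.08 * w n) / (1 - 2 * w n) := by
          field_simp
          ring
        rw [this]
        have : 0 ≤ 0.04 - 8.08 * w n := by linarith
        positivity
      rw [← w_sq]
      linarith
    · have := Real.log_le_sub_one_of_pos hpos
      linarith
  · rw [factor, if_neg fun h => hsq h.2, wSquarefree, if_neg hsq, Real.log_one]
    constructor
    · have : (0 : ℝ) ≤ 4.04 * (1 / (n : ℝ) ^ 3) := by positivity
      linarith
    · simp

lemma prod_factor_eq_exp (n : ℕ) : ∏ i ∈ Finset.range n, factor (i + 2) =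
    Real.exp (∑ i ∈ Finset.range (n + 2), Real.log (factor i)) := by
  have h0 : factor 0 = 1 := by simp [factor]
  have h1 : factor 1 = 1 := by simp [factor]
  rw [Real.exp_sum, Finset.prod_range_succ', Finset.prod_range_succ']
  simp only [Real.exp_log (factor_pos _), zero_add, h0, h1, Real.log_one, Real.exp_zero,
    mul_one]

/-- Beyond `1000`, `log (1 - 2 w)` is replaced by `-2 w`, and the tail of the squarefree sum is the
full sum minus its initial part; `R` collects the second-order errors, bounded through the tail of
`∑ 1 / n ^ 3`. -/
lemma C_two_eq : ∃ R : ℝ, -(4.04 / (2 * 1000 * 1001)) ≤ R ∧ R ≤ 0 ∧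
    C 2 = (∏ i ∈ Finset.range 999, factor (i + 2)) *
      Real.exp (2 * (∑ n ∈ Finset.range 1001, wSquarefree n) - 2 * (∑' n, wSquarefree n) + R) := by
  obtain ⟨L, hC, hL⟩ := exists_hasSum_log_factor
  have hs1 := (summable_nat_add_iff 1001).2 hL.summable
  have hs2 := ((summable_nat_add_iff 1001).2 summable_wSquarefree).mul_left 2
  have hL1 := hL.summable.sum_add_tsum_nat_add 1001
  have hU1 := summable_wSquarefree.sum_add_tsum_nat_add 1001
  rw [hL.tsum_eq] at hL1
  refine ⟨∑' n, (Real.log (factor (n + 1001)) + 2 * wSquarefree (n + 1001)), ?_, ?_, ?_⟩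
  · have h1 : Summable fun n : ℕ => -(4.04 * (1 / ((n + 1001 : ℕ) : ℝ) ^ 3)) :=
      (((summable_nat_add_iff 1001).2 summable_inv_cube).mul_left 4.04).neg
    have h2 := h1.tsum_le_tsum (fun n => (log_factor_add_bounds (n := n + 1001) (by omega)).1)
      (hs1.add hs2)
    rw [tsum_neg, tsum_mul_left] at h2
    have h3 := tsum_inv_cube_tail_le
    refine le_trans ?_ h2
    rw [neg_le_neg_iff, div_eq_mul_one_div]
    gcongr
  · exact tsum_nonpos fun n => (log_factor_add_bounds (n := n + 1001) (by omega)).2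
  · rw [hs1.tsum_add hs2, tsum_mul_left]
    have hprod : ∏ i ∈ Finset.range 999, factor (i + 2) =
        Real.exp (∑ n ∈ Finset.range 1001, Real.log (factor n)) := prod_factor_eq_exp 999
    rw [hprod, hC, ← Real.exp_add]
    refine congrArg Real.exp ?_
    linarith

set_option maxRecDepth 100000 in
-- The kernel evaluates these natural-number programs directly. In each pair of bounds on a sum over
-- all `b ≤ 1000`, the two constants differ by one unit per summand.
lemma sumUpTo_wLo_ge : Nat.ble 2549145602413 (sumUpTo wLo 1000) = true := by decide +kernel

set_option maxRecDepth 100000 in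
lemma sumUpTo_wHi_le : Nat.ble (sumUpTo wHi 1000) 2549145603413 = true := by decide +kernel

set_option maxRecDepth 100000 in
lemma sumUpTo_sqf_wLo_ge :
    Nat.ble 2134777487055 (sumUpTo (fun b => cond (sqf b) (wLo b) 0) 1000) = true := by
  decide +kernel

set_option maxRecDepth 100000 in
lemma sumUpTo_sqf_wHi_le :
    Nat.ble (sumUpTo (fun b => cond (sqf b) (wHi b) 0) 1000) 2134777487663 = true := by
  decide +kernel

set_option maxRecDepth 100000 in
lemma sumUpTo_inv_cube_ge :
    Nat.ble 1202056403170 (sumUpTo (fun b => scale / b ^ 3) 1000) = true := by decide +kernel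

set_option maxRecDepth 100000 in
lemma sumUpTo_inv_cube_le :
    Nat.ble (sumUpTo (fun b => scale / b ^ 3 + 1) 1000) 1202056404170 = true := by decide +kernel

set_option maxRecDepth 100000 in
lemma prodLo_ge : Nat.ble 53165093996 (prodLo 999) = true := by decide +kernel

set_option maxRecDepth 100000 in
lemma prodHi_le : Nat.ble (prodHi 999) 53165094625 = true := by decide +kernel

lemma le_of_ble_cast {a b : ℕ} (h : Nat.ble a b = true) : (a : ℝ) ≤ b := by
  exact_mod_cast Nat.le_of_ble_eq_true h

lemma sum_w_bounds :
    2.549145602413 ≤ ∑ n ∈ Finset.range 1001, w n ∧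
      ∑ n ∈ Finset.range 1001, w n ≤ 2.549145603413 := by
  have h0 : w 0 = 0 := by simp [w]
  have h1 := (le_of_ble_cast sumUpTo_wLo_ge).trans
    (sumUpTo_le (g := w) h0.ge fun b hb _ => wLo_le hb)
  have h2 := (le_sumUpTo (g := w) h0.le fun b hb _ => le_wHi hb).trans
    (le_of_ble_cast sumUpTo_wHi_le)
  rw [cast_scale] at h1 h2
  exact ⟨by push_cast at h1; linarith, by push_cast at h2; linarith⟩

lemma sum_wSquarefree_bounds :
    2.134777487055 ≤ ∑ n ∈ Finset.range 1001, wSquarefree n ∧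
      ∑ n ∈ Finset.range 1001, wSquarefree n ≤ 2.134777487663 := by
  have h0 : wSquarefree 0 = 0 := by simp [wSquarefree]
  have h1 := (le_of_ble_cast sumUpTo_sqf_wLo_ge).trans
    (sumUpTo_le (g := wSquarefree) h0.ge fun b hb hb2 => by
      have hsq := sqf_iff hb (by omega)
      unfold wSquarefree
      cases h : sqf b with
      | false => rw [if_neg fun h2 => by rw [hsq.2 h2] at h; cases h]; simp
      | true => rw [if_pos (hsq.1 h)]; exact wLo_le hb)
  have h2 := (le_sumUpTo (g := wSquarefree) h0.le fun b hb hb2 => by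
      have hsq := sqf_iff hb (by omega)
      unfold wSquarefree
      cases h : sqf b with
      | false => rw [if_neg fun h2 => by rw [hsq.2 h2] at h; cases h]; simp
      | true => rw [if_pos (hsq.1 h)]; exact le_wHi hb).trans
    (le_of_ble_cast sumUpTo_sqf_wHi_le)
  rw [cast_scale] at h1 h2
  exact ⟨by push_cast at h1; linarith, by push_cast at h2; linarith⟩

lemma sum_inv_cube_bounds :
    1.202056403170 ≤ ∑ n ∈ Finset.range 1001, 1 / (n : ℝ) ^ 3 ∧
      ∑ n ∈ Finset.range 1001, 1 / (n : ℝ) ^ 3 ≤ 1.202056404170 := by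
  have h1 := (le_of_ble_cast sumUpTo_inv_cube_ge).trans
    (sumUpTo_le (g := fun n : ℕ => 1 / (n : ℝ) ^ 3) (by simp) fun b hb _ => by
      refine Nat.cast_div_le.trans ?_
      rw [mul_one_div]; push_cast; rfl)
  have h2 := (le_sumUpTo (g := fun n : ℕ => 1 / (n : ℝ) ^ 3) (by simp) fun b hb _ => by
      rw [mul_one_div, Nat.cast_add, Nat.cast_one]
      refine (Nat.lt_floor_add_one _).le.trans ?_
      rw [← Nat.cast_pow, Nat.floor_div_eq_div]).trans
    (le_of_ble_cast sumUpTo_inv_cube_le)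
  rw [cast_scale] at h1 h2
  generalize ∑ n ∈ Finset.range 1001, 1 / (n : ℝ) ^ 3 = s at h1 h2 ⊢
  exact ⟨by push_cast at h1; linarith, by push_cast at h2; linarith⟩

lemma prod_factor_bounds :
    0.053165093996 ≤ ∏ i ∈ Finset.range 999, factor (i + 2) ∧
      ∏ i ∈ Finset.range 999, factor (i + 2) ≤ 0.053165094625 := by
  have h1 := (le_of_ble_cast prodLo_ge).trans (prodLo_le (n := 999) (by norm_num))
  have h2 := (le_prodHi (n := 999) (by norm_num)).trans (le_of_ble_cast prodHi_le)
  rw [cast_scale] at h1 h2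
  exact ⟨by push_cast at h1; linarith, by push_cast at h2; linarith⟩

lemma tsum_w_bounds : 2.6123753461 ≤ ∑' n, w n ∧ ∑' n, w n ≤ 2.6123753513 := by
  rw [← summable_w.sum_add_tsum_nat_add 1001]
  have h1 := sum_w_bounds
  have h2 := tsum_w_tail_le
  have h3 := le_tsum_w_tail
  have h4 : 2 / √1000.5 ≤ 0.0632297478 := by
    have : 31.63068129 ≤ √1000.5 := Real.le_sqrt_of_sq_le (by norm_num)
    rw [div_le_iff₀ (by linarith)]
    linarith
  have h5 : 0.0632297437 ≤ 2 / √(1000.5 + 1 / 8000) := by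
    have : √(1000.5 + 1 / 8000) ≤ 31.63068332 := Real.sqrt_le_iff.2 ⟨by norm_num, by norm_num⟩
    have h6 : 0 < √(1000.5 + 1 / 8000) := Real.sqrt_pos.2 (by norm_num)
    rw [le_div_iff₀ h6]
    linarith
  constructor <;> linarith [h1.1, h1.2]

lemma tsum_inv_cube_bounds :
    1.202056902 ≤ ∑' n : ℕ, 1 / (n : ℝ) ^ 3 ∧ ∑' n : ℕ, 1 / (n : ℝ) ^ 3 ≤ 1.202056904 := by
  rw [← summable_inv_cube.sum_add_tsum_nat_add 1001]
  have h1 := sum_inv_cube_bounds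
  have h2 := tsum_inv_cube_tail_le
  have h3 := le_tsum_inv_cube_tail
  generalize ∑ n ∈ Finset.range 1001, 1 / (n : ℝ) ^ 3 = s at h1 ⊢
  constructor <;> linarith [h1.1, h1.2]

lemma C_two_bounds : (0.049227 : ℝ) ≤ C 2 ∧ C 2 < (0.049228 : ℝ) := by
  obtain ⟨R, hR1, hR2, hC⟩ := C_two_eq
  have hS := sum_wSquarefree_bounds
  have hP := prod_factor_bounds
  have hT := tsum_w_bounds
  have hW := tsum_inv_cube_bounds
  have hmul := tsum_wSquarefree_mul
  set Z := ∑' n, wSquarefree n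
  set W := ∑' n : ℕ, 1 / (n : ℝ) ^ 3
  set P := ∏ i ∈ Finset.range 999, factor (i + 2)
  -- Both bounds on `Z` come from `Z * W = ∑' n, w n`, dividing the enclosure of `ζ(3/2)` by that of
  -- `ζ(3)`.
  have hZ1 : Z ≤ 2.173254317 := by
    by_contra hcon
    push Not at hcon
    nlinarith [hT.2, hW.1]
  have hZ2 : 2.173254308 ≤ Z := by
    by_contra hcon
    push Not at hcon
    nlinarith [hT.1, hW.2]
  rw [hC]
  set E := 2 * (∑ n ∈ Finset.range 1001, wSquarefree n) - 2 * Z + R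
  have hE1 : -0.076956 ≤ E := by norm_num at hR1; linarith [hS.1]
  have hE2 : E ≤ -0.076953 := by linarith [hS.2]
  -- Six Taylor terms at the rational endpoints of the enclosure of `E` suffice.
  have hexp1 : 0.92593 ≤ Real.exp E := by
    refine le_trans ?_ (Real.exp_le_exp.2 hE1)
    have := (abs_le.1 (Real.exp_bound (x := -0.076956) (by norm_num) (n := 6) (by norm_num))).1
    norm_num [Finset.sum_range_succ, Nat.factorial] at this ⊢
    linarith
  have hexp2 : Real.exp E ≤ 0.92594 := by
    refine (Real.exp_le_exp.2 hE2).trans ?_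
    have := (abs_le.1 (Real.exp_bound (x := -0.076953) (by norm_num) (n := 6) (by norm_num))).2
    norm_num [Finset.sum_range_succ, Nat.factorial] at this ⊢
    linarith
  constructor
  · calc (0.049227 : ℝ) ≤ 0.053165093996 * 0.92593 := by norm_num
      _ ≤ P * Real.exp E := mul_le_mul hP.1 hexp1 (by norm_num) (by linarith [hP.1])
  · calc P * Real.exp E ≤ 0.053165094625 * 0.92594 :=
          mul_le_mul hP.2 hexp2 (Real.exp_pos _).le (by norm_num)
      _ < 0.049228 := by norm_num

end ConstantTwo

end KFull

theorem mainTheorem2 :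
    (∀ k : ℕ, 2 ≤ k →
      Multipliable (fun l : KFull.Lambda k => 1 - 2 / (l : ℝ)) ∧
      0 < KFull.C k ∧
      KFull.HasDensity (KFull.B k) (KFull.C k) ∧
      {n : ℕ | 1 ≤ n ∧ ∀ m : ℕ, n ^ k < m → m < (n + 2) ^ k → KFull.IsFull k m →
        m = (n + 1) ^ k}.Infinite) ∧
    ((0.049227 : ℝ) ≤ KFull.C 2 ∧ KFull.C 2 < (0.049228 : ℝ)) := by
  refine ⟨fun k hk => ⟨KFull.multipliable_one_sub hk, KFull.C_pos hk, KFull.hasDensity_B hk, ?_⟩,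
    KFull.C_two_bounds⟩
  exact (KFull.B_infinite hk).mono fun n hn =>
    ⟨hn.1, fun m h1 h2 hm => KFull.eq_succ_pow_of_mem_B hn h1 h2 hm⟩
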